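/- Let $d \ge 2$. Internal DLA on $\mathbb{Z}^d$ is the random growth process defined by $A(0)=\emptyset$ and, for each integer $n \ge 0$, $A(n+1) = A(n) \cup \{x\}$, where $x$ is the first site outside $A(n)$ visited by a new simple random walk on $\mathbb{Z}^d$ started at the origin, the walks of different particles being independent (so $A(1)=\{0\}$). For $z \in \mathbb{Z}^d$ and real $m>0$ write $\mathbf{B}(z,m) = \{y \in \mathbb{Z}^d : |y-z| < m\}$, where $|\cdot|$ is the Euclidean norm. (i) Let $d = 2$. There are absolute constants $b, C_0, c > 0$ such that for all real $m > 0$, all $z \in \mathbb{Z}^2$ with $0 \notin \mathbf{B}(z,m)$, and all integers $n \ge 0$, $$\mathbb{P}\{ z \in A(n),\ \#(A(n) \cap \mathbf{B}(z,m)) \le b m^2 \} \le C_0 e^{-c m^2/\log m},$$ where for $m = 1$ the undefined quotient $m^2/\log m$ is read as $0$. (ii) For each $d \ge 3$ there are constants $b, C_0, c > 0$, depending only on $d$, such that for all real $m > 0$, all $z \in \mathbb{Z}^d$ with $0 \notin \mathbf{B}(z,m)$, and all integers $n \ge 0$, $$\mathbb{P}\{ z \in A(n),\ \#(A(n) \cap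 \mathbf{B}(z,m)) \le b m^d \} \le C_0 e^{-c m^2}.$$ -/

import Mathlib

namespace IDLA

/-- The integer lattice `ℤ^d`. -/
abbrev Lattice (d : ℕ) : Type := Fin d → ℤ

/-- The `2 d` possible steps of simple random walk on `ℤ^d`: a coordinate direction together
with a sign (`true` for `+`, `false` for `-`). -/
abbrev Step (d : ℕ) : Type := Fin d × Bool

/-- The signed unit vector `± e_i` described by a step. -/
def Step.toVec {d : ℕ} (s : Step d) : Lattice d :=
  Pi.single s.1 (if s.2 then 1 else -1)

/-- Sample space: for each particle `k` and each time `t`, the step which particle `k` makes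
from time `t` to time `t + 1`; it is indexed by the pair `(k, t)`. -/
abbrev Sample (d : ℕ) : Type := ℕ × ℕ → Step d

/-- The probability measure `ℙ` under which all steps of all particles are independent and
uniformly distributed on the `2 d` unit vectors `± e_i`. -/
noncomputable def prob (d : ℕ) [NeZero d] : MeasureTheory.Measure (Sample d) :=
  MeasureTheory.Measure.infinitePi
    (fun _ : ℕ × ℕ => (PMF.uniformOfFintype (Step d)).toMeasure)

/-- The position at time `t` of the simple random walk of particle `k`, started at `0`. -/
def walk {d : ℕ} (ω : Sample d) (k t : ℕ) : Lattice d :=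
  ∑ s ∈ Finset.range t, Step.toVec (ω (k, s))

/-- The first time that the walk of particle `k` is outside the finite set `A`.  On the null event
that the walk stays in `A` forever this is `0`; the site `0` is then added to a cluster that
contains it already, so that the cluster stays the same. -/
noncomputable def exitTime {d : ℕ} (ω : Sample d) (k : ℕ) (A : Finset (Lattice d)) : ℕ :=
  sInf {t : ℕ | walk ω k t ∉ A}

/-- The internal DLA cluster `A(n)`: `A(0) = ∅`, and `A(n + 1)` is `A(n)` together with the first
site outside `A(n)` visited by a new simple random walk started at the origin.  In particular
`A(1) = {0}`. -/
noncomputable def cluster {d : ℕ} (ω : Sample d) : ℕ → Finset (Lattice d)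
  | 0 => ∅
  | n + 1 => insert (walk ω n (exitTime ω n (cluster ω n))) (cluster ω n)

/-- The Euclidean norm of a lattice point. -/
noncomputable def euclNorm {d : ℕ} (x : Lattice d) : ℝ :=
  Real.sqrt (∑ i, (x i : ℝ) ^ 2)

/-- The lattice points of the open Euclidean ball of radius `m` centred at `z`. -/
def ball {d : ℕ} (z : Lattice d) (m : ℝ) : Set (Lattice d) :=
  {y | euclNorm (y - z) < m}

/-- The event that `z` belongs to `A(n)` while at most `v` sites of `A(n)` lie in the ball of
radius `m` around `z`. -/
def thinTentacle {d : ℕ} (n : ℕ) (z : Lattice d) (m v : ℝ) : Set (Sample d) :=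
  {ω | z ∈ cluster ω n ∧ (((cluster ω n : Set (Lattice d)) ∩ ball z m).ncard : ℝ) ≤ v}

end IDLA

/-!
A particle that reaches the middle of a thin part of the cluster is likely to stop there, so that it
is costly to build a long thin tentacle. The cost is counted by an exponential supermartingale.

*Escape from thin sets.* There is `β > 0` such that, if at most `β w ^ d` sites of a ball of radius
`w / 4` are occupied, the walk from the centre meets a free site of the ball with probability at
least `1 / 2` before it leaves the ball (`exists_escape_density`). Indeed, after a small multiple of
`w ^ 2` steps it is still likely to be in the ball, because its squared distance grows by one per
step on average, and it is unlikely to be at an occupied site, because the transition probabilities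
are at most a multiple of `t ^ (- d / 2)` (`exists_heat_le`, proved by Fourier inversion).

*The supermartingale.* Take disjoint shells around `z`, the one of width `w` holding at most
`β w ^ d` sites. Give every site the weight `3 / 2` for each shell that encloses it and `1 / 2` if
it is in a shell. A particle that reaches the middle of a shell is stopped in it with probability at
least `1 / 2`, and `(3 / 2 + 1 / 2) / 2 = 1`; so the mean weight of the site where a particle settles
is at most one (`exists_thin_density`, a maximum principle argument, and `lintegral_exit_le`). As the
particles are independent, the product of the weights of all sites of the cluster has mean at most
one, as long as the shells are thin (`exists_lintegral_totalWeight_le`). If `N r` is the number of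
sites of the cluster at distance less than `r` from `z`, and each shell has at most a quarter as many
sites as it encloses, the product is at least the exponential of `1 / 8` of the sum of `N lo` over
the inner radii `lo` of the shells. Hence a given function `N` has at most the inverse of this as its
probability (`exists_prob_le_exp`).

*Choice of the shells.* Let `z` be in the cluster. The walk that occupied `z` crossed all distances,
so that `N` is strictly increasing up to the radius `R`, about `m`. On a level, where
`2 ^ (d k) ≤ N < 2 ^ (d (k + 1))`, with `t` radii, equal shells are cut, as narrow as their average
number of sites permits, and at least half of them are good (`exists_goodShells_of_level`). If
`N R` is at most a small multiple of `R ^ d`, levels too narrow for this take up only a small part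
of the radii. In dimension two each other level contributes a multiple of `t ^ 2` to the sum; there
are at most about `log R` levels, and the Cauchy-Schwarz inequality gives `R ^ 2 / log R`
(`exists_goodShells_two`). In higher dimension one level already contributes a multiple of `R ^ 2`
(`exists_goodShells_of_three_le`). The number of functions `N` is at most `exp (O(R log R))`, so a
union bound finishes the proof.
-/

namespace IDLA

open MeasureTheory Finset ProbabilityTheory
open scoped ENNReal

variable {d : ℕ}

/-! ### The averaging operator of simple random walk -/

/-- The average of `h` over the `2 d` neighbours of `x`. -/
noncomputable def stepAvg (h : Lattice d → ℝ) (x : Lattice d) : ℝ :=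
  (∑ s : Step d, h (x + s.toVec)) / (2 * d)

lemma sum_step (g : Lattice d → ℝ) :
    ∑ s : Step d, g s.toVec = ∑ i, (g (Pi.single i 1) + g (Pi.single i (-1))) := by
  rw [Fintype.sum_prod_type]
  refine Finset.sum_congr rfl fun i _ => ?_
  simp [Step.toVec]

lemma card_step : (Fintype.card (Step d) : ℝ) = 2 * d := by
  simp [mul_comm]

lemma stepAvg_mono {g h : Lattice d → ℝ} {x : Lattice d}
    (H : ∀ s : Step d, g (x + s.toVec) ≤ h (x + s.toVec)) : stepAvg g x ≤ stepAvg h x := by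
  unfold stepAvg
  gcongr with s
  exact H s

lemma stepAvg_const [NeZero d] (c : ℝ) (x : Lattice d) : stepAvg (fun _ => c) x = c := by
  have : (d : ℝ) ≠ 0 := Nat.cast_ne_zero.2 (NeZero.ne d)
  unfold stepAvg
  rw [Finset.sum_const, Finset.card_univ, nsmul_eq_mul, card_step]
  field_simp

lemma stepAvg_add (g h : Lattice d → ℝ) (x : Lattice d) :
    stepAvg (fun y => g y + h y) x = stepAvg g x + stepAvg h x := by
  simp [stepAvg, Finset.sum_add_distrib, add_div]

lemma stepAvg_const_mul (c : ℝ) (h : Lattice d → ℝ) (x : Lattice d) :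
    stepAvg (fun y => c * h y) x = c * stepAvg h x := by
  simp [stepAvg, ← Finset.mul_sum, mul_div_assoc]

lemma stepAvg_sum {ι : Type*} (t : Finset ι) (h : ι → Lattice d → ℝ) (x : Lattice d) :
    stepAvg (fun y => ∑ a ∈ t, h a y) x = ∑ a ∈ t, stepAvg (h a) x := by
  simp only [stepAvg]
  rw [Finset.sum_comm, Finset.sum_div]

/-! ### Decay of the transition probabilities -/

/-- The transition probabilities of simple random walk: `heat t y` is the probability that the
walk started at `y` is at `0` after `t` steps. -/
noncomputable def heat : ℕ → Lattice d → ℝ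
  | 0 => fun y => if y = 0 then 1 else 0
  | t + 1 => stepAvg (heat t)

lemma heat_nonneg (t : ℕ) (y : Lattice d) : 0 ≤ heat t y := by
  induction t generalizing y with
  | zero => simp only [heat]; split_ifs <;> norm_num
  | succ t ih =>
    exact div_nonneg (Finset.sum_nonneg fun s _ => ih _) (by positivity)

/-- Lebesgue measure on the frequency cube `(0, π]^d`, of total mass `π ^ d`. -/
noncomputable def freqMeasure (d : ℕ) : Measure (Fin d → ℝ) :=
  Measure.pi fun _ => volume.restrict (Set.Ioc 0 Real.pi)

instance : IsFiniteMeasure (freqMeasure d) := by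
  unfold freqMeasure
  have : IsFiniteMeasure ((volume : Measure ℝ).restrict (Set.Ioc 0 Real.pi)) :=
    ⟨by simp⟩
  infer_instance

/-- The real character `∏ cos (θ_i y_i)`, an eigenfunction of `stepAvg`. -/
noncomputable def cosProd (θ : Fin d → ℝ) (y : Lattice d) : ℝ := ∏ i, Real.cos (θ i * y i)

/-- The eigenvalue of `stepAvg` for the character `cosProd θ`. -/
noncomputable def symbol (θ : Fin d → ℝ) : ℝ := (∑ i, Real.cos (θ i)) / d

lemma cosProd_add_single (θ : Fin d → ℝ) (y : Lattice d) (i : Fin d) :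
    cosProd θ (y + Pi.single i 1) + cosProd θ (y + Pi.single i (-1)) =
      2 * Real.cos (θ i) * cosProd θ y := by
  have key : ∀ e : ℤ, cosProd θ (y + Pi.single i e) =
      Real.cos (θ i * (y i + e)) * ∏ j ∈ univ.erase i, Real.cos (θ j * y j) := by
    intro e
    unfold cosProd
    rw [← Finset.mul_prod_erase univ _ (Finset.mem_univ i)]
    congr 1
    · simp
    · refine Finset.prod_congr rfl fun j hj => ?_
      rw [Pi.add_apply, Pi.single_eq_of_ne (Finset.ne_of_mem_erase hj), add_zero]
  have h0 : cosProd θ y = Real.cos (θ i * y i) * ∏ j ∈ univ.erase i, Real.cos (θ j * y j) := by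
    unfold cosProd
    rw [← Finset.mul_prod_erase univ _ (Finset.mem_univ i)]
  rw [key, key, h0]
  push_cast
  rw [show θ i * ((y i : ℝ) + 1) = θ i * y i + θ i by ring,
    show θ i * ((y i : ℝ) + -1) = θ i * y i - θ i by ring, Real.cos_add, Real.cos_sub]
  ring

lemma stepAvg_cosProd (θ : Fin d → ℝ) (y : Lattice d) :
    stepAvg (cosProd θ) y = symbol θ * cosProd θ y := by
  unfold stepAvg symbol
  rw [sum_step (fun v => cosProd θ (y + v))]
  simp only [cosProd_add_single]
  rw [← Finset.sum_mul, ← Finset.mul_sum]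
  rcases Nat.eq_zero_or_pos d with h | h
  · subst h; simp
  · have : (d : ℝ) ≠ 0 := by positivity
    field_simp

lemma abs_cosProd_le (θ : Fin d → ℝ) (y : Lattice d) : |cosProd θ y| ≤ 1 := by
  unfold cosProd
  rw [Finset.abs_prod]
  exact Finset.prod_le_one (fun _ _ => abs_nonneg _) fun _ _ => Real.abs_cos_le_one _

lemma abs_symbol_le (θ : Fin d → ℝ) : |symbol θ| ≤ (∑ i, |Real.cos (θ i)|) / d := by
  unfold symbol
  rw [abs_div, Nat.abs_cast]
  gcongr
  exact Finset.abs_sum_le_sum_abs _ _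

lemma abs_symbol_le_one (θ : Fin d → ℝ) : |symbol θ| ≤ 1 := by
  refine (abs_symbol_le θ).trans (div_le_one_of_le₀ ?_ (by positivity))
  calc ∑ i, |Real.cos (θ i)| ≤ ∑ _i : Fin d, (1 : ℝ) :=
        Finset.sum_le_sum fun i _ => Real.abs_cos_le_one _
    _ = d := by simp

lemma continuous_cosProd (y : Lattice d) : Continuous fun θ : Fin d → ℝ => cosProd θ y := by
  unfold cosProd; fun_prop

lemma continuous_symbol : Continuous (symbol : (Fin d → ℝ) → ℝ) := by
  unfold symbol; fun_prop

lemma integrable_symbol_pow_mul (t : ℕ) (y : Lattice d) :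
    Integrable (fun θ => symbol θ ^ t * cosProd θ y) (freqMeasure d) := by
  refine Integrable.of_bound (C := 1)
    ((continuous_symbol.pow t).mul (continuous_cosProd y)).aestronglyMeasurable
    (Filter.Eventually.of_forall fun θ => ?_)
  rw [Real.norm_eq_abs, abs_mul, abs_pow]
  exact mul_le_one₀ (pow_le_one₀ (abs_nonneg _) (abs_symbol_le_one θ)) (abs_nonneg _)
    (abs_cosProd_le θ y)

lemma integral_cos_int_mul (k : ℤ) :
    ∫ θ in Set.Ioc 0 Real.pi, Real.cos (θ * k) = if k = 0 then Real.pi else 0 := by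
  rw [← intervalIntegral.integral_of_le Real.pi_pos.le]
  split_ifs with h
  · simp [h]
  · have hk : (k : ℝ) ≠ 0 := by exact_mod_cast h
    rw [intervalIntegral.integral_comp_mul_right (fun x => Real.cos x) hk]
    simp [mul_comm Real.pi, Real.sin_int_mul_pi]

/-- Fourier inversion for the transition probabilities. By the reflection symmetries of the walk the
real characters `cosProd θ` suffice. -/
lemma heat_eq_integral [NeZero d] (t : ℕ) (y : Lattice d) :
    heat t y * Real.pi ^ d = ∫ θ, symbol θ ^ t * cosProd θ y ∂freqMeasure d := by
  induction t generalizing y with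
  | zero =>
    simp only [pow_zero, one_mul, heat]
    unfold cosProd freqMeasure
    rw [integral_fintype_prod_eq_prod (fun i x => Real.cos (x * y i))]
    simp only [integral_cos_int_mul]
    split_ifs with h
    · simp [h]
    · obtain ⟨i, hi⟩ := Function.ne_iff.1 h
      rw [zero_mul, Finset.prod_eq_zero (Finset.mem_univ i)]
      simpa using hi
  | succ t ih =>
    have : ∀ θ : Fin d → ℝ, symbol θ ^ (t + 1) * cosProd θ y =
        (∑ s : Step d, symbol θ ^ t * cosProd θ (y + s.toVec)) / (2 * d) := by
      intro θ
      rw [← Finset.mul_sum, mul_div_assoc, ← stepAvg, stepAvg_cosProd]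
      ring
    simp only [this]
    rw [integral_div, integral_finsetSum _ fun s _ => integrable_symbol_pow_mul t _]
    simp only [← ih, heat, stepAvg]
    rw [← Finset.sum_mul]
    ring

/-- The absolute value is there because of the parity of the walk: `|symbol θ|` is also close to one
near `θ = (π, …, π)`. Hence the two Gaussians. -/
lemma exp_neg_mul_one_sub_abs_cos_le {a θ : ℝ} (ha : 0 ≤ a) (h0 : 0 ≤ θ) (h1 : θ ≤ Real.pi) :
    Real.exp (-(a * (1 - |Real.cos θ|))) ≤
      Real.exp (-(2 * a / Real.pi ^ 2) * θ ^ 2) +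
        Real.exp (-(2 * a / Real.pi ^ 2) * (θ - Real.pi) ^ 2) := by
  have key : ∀ x : ℝ, |x| ≤ Real.pi →
      -(a * (1 - Real.cos x)) ≤ -(2 * a / Real.pi ^ 2) * x ^ 2 := by
    intro x hx
    have := mul_le_mul_of_nonneg_left (Real.cos_le_one_sub_mul_cos_sq hx) ha
    calc -(a * (1 - Real.cos x)) = a * Real.cos x - a := by ring
      _ ≤ a * (1 - 2 / Real.pi ^ 2 * x ^ 2) - a := by linarith
      _ = _ := by ring
  rcases le_total 0 (Real.cos θ) with hc | hc
  · rw [abs_of_nonneg hc]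
    have := Real.exp_le_exp.2 (key θ (by rw [abs_of_nonneg h0]; exact h1))
    have := Real.exp_pos (-(2 * a / Real.pi ^ 2) * (θ - Real.pi) ^ 2)
    linarith
  · rw [abs_of_nonpos hc, ← Real.cos_sub_pi]
    have := Real.exp_le_exp.2 (key (θ - Real.pi) (by rw [abs_le]; constructor <;> linarith))
    have := Real.exp_pos (-(2 * a / Real.pi ^ 2) * θ ^ 2)
    linarith

lemma integral_exp_neg_mul_one_sub_abs_cos_le {a : ℝ} (ha : 0 < a) :
    ∫ θ in Set.Ioc 0 Real.pi, Real.exp (-(a * (1 - |Real.cos θ|))) ≤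
      2 * √(Real.pi / (2 * a / Real.pi ^ 2)) := by
  set b := 2 * a / Real.pi ^ 2 with hb
  have hbpos : 0 < b := by positivity
  have i1 : Integrable fun θ : ℝ => Real.exp (-b * θ ^ 2) := integrable_exp_neg_mul_sq hbpos
  have i2 : Integrable fun θ : ℝ => Real.exp (-b * (θ - Real.pi) ^ 2) := i1.comp_sub_right _
  calc _ ≤ ∫ θ in Set.Ioc 0 Real.pi,
        (Real.exp (-b * θ ^ 2) + Real.exp (-b * (θ - Real.pi) ^ 2)) := by
        refine setIntegral_mono_on ?_ (i1.add i2).integrableOn measurableSet_Ioc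
          fun θ hθ => exp_neg_mul_one_sub_abs_cos_le ha.le hθ.1.le hθ.2
        exact ((by fun_prop : Continuous fun θ : ℝ =>
          Real.exp (-(a * (1 - |Real.cos θ|)))).continuousOn.integrableOn_Icc).mono_set
            Set.Ioc_subset_Icc_self
    _ ≤ ∫ θ, (Real.exp (-b * θ ^ 2) + Real.exp (-b * (θ - Real.pi) ^ 2)) :=
        setIntegral_le_integral (i1.add i2) (Filter.Eventually.of_forall fun θ => by positivity)
    _ = 2 * √(Real.pi / b) := by
        rw [integral_add i1 i2,
          integral_sub_right_eq_self (fun θ => Real.exp (-b * θ ^ 2)) Real.pi, integral_gaussian]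
        ring

/-- The on-diagonal decay `t ^ (- d / 2)` of the transition probabilities. -/
lemma exists_heat_le (d : ℕ) [NeZero d] :
    ∃ H : ℝ, 0 < H ∧ ∀ (t : ℕ) (y : Lattice d), 0 < t → heat t y * √t ^ d ≤ H := by
  have hd : (0 : ℝ) < d := Nat.cast_pos.2 (Nat.pos_of_ne_zero (NeZero.ne d))
  refine ⟨(2 * √(Real.pi ^ 3 * d / 2) / Real.pi) ^ d, by positivity, fun t y ht => ?_⟩
  have ht' : (0 : ℝ) < t := Nat.cast_pos.2 ht
  have hpt : ∀ θ : Fin d → ℝ, symbol θ ^ t * cosProd θ y ≤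
      ∏ i, Real.exp (-(t / d * (1 - |Real.cos (θ i)|))) := by
    intro θ
    calc symbol θ ^ t * cosProd θ y ≤ |symbol θ ^ t * cosProd θ y| := le_abs_self _
      _ ≤ |symbol θ| ^ t * 1 := by
        rw [abs_mul, abs_pow]
        exact mul_le_mul_of_nonneg_left (abs_cosProd_le θ y) (by positivity)
      _ ≤ Real.exp (-((∑ i, (1 - |Real.cos (θ i)|)) / d)) ^ t := by
        rw [mul_one]
        refine pow_le_pow_left₀ (abs_nonneg _) ((abs_symbol_le θ).trans ?_) t
        refine le_trans (le_of_eq ?_) (Real.add_one_le_exp _)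
        rw [Finset.sum_sub_distrib]
        simp
        field_simp
        ring
      _ = _ := by
        rw [← Real.exp_nat_mul, ← Real.exp_sum]
        congr 1
        rw [Finset.sum_neg_distrib, ← Finset.mul_sum]
        ring
  have hint : ∫ θ, symbol θ ^ t * cosProd θ y ∂freqMeasure d ≤
      (2 * √(Real.pi / (2 * (t / d) / Real.pi ^ 2))) ^ d := by
    calc _ ≤ ∫ θ, ∏ i, Real.exp (-(t / d * (1 - |Real.cos (θ i)|))) ∂freqMeasure d := by
          refine integral_mono (integrable_symbol_pow_mul t y) ?_ hpt
          refine Integrable.of_bound (C := 1) (Continuous.aestronglyMeasurable (by fun_prop))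
            (Filter.Eventually.of_forall fun θ => ?_)
          rw [Real.norm_eq_abs, abs_of_nonneg (by positivity)]
          refine Finset.prod_le_one (fun _ _ => (Real.exp_pos _).le) fun i _ => ?_
          rw [Real.exp_le_one_iff, neg_nonpos]
          exact mul_nonneg (by positivity) (sub_nonneg.2 (Real.abs_cos_le_one _))
      _ = ∏ _i : Fin d, ∫ θ in Set.Ioc 0 Real.pi, Real.exp (-(t / d * (1 - |Real.cos θ|))) :=
          integral_fintype_prod_eq_prod (fun _ x => Real.exp (-(t / d * (1 - |Real.cos x|))))
      _ ≤ ∏ _i : Fin d, (2 * √(Real.pi / (2 * (t / d) / Real.pi ^ 2))) :=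
          Finset.prod_le_prod (fun _ _ => integral_nonneg fun _ => (Real.exp_pos _).le)
            fun _ _ => integral_exp_neg_mul_one_sub_abs_cos_le (by positivity)
      _ = _ := by simp
  rw [← heat_eq_integral] at hint
  have e : √(Real.pi / (2 * (t / d) / Real.pi ^ 2)) * √t = √(Real.pi ^ 3 * d / 2) := by
    rw [← Real.sqrt_mul (by positivity)]
    congr 1
    field_simp
  rw [div_pow, le_div_iff₀ (by positivity), ← e]
  calc heat t y * √t ^ d * Real.pi ^ d = (heat t y * Real.pi ^ d) * √t ^ d := by ring
    _ ≤ _ := mul_le_mul_of_nonneg_right hint (by positivity)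
    _ = _ := by rw [← mul_pow]; congr 1; ring

/-! ### The Euclidean norm on the lattice -/

lemma euclNorm_nonneg (x : Lattice d) : 0 ≤ euclNorm x := Real.sqrt_nonneg _

lemma euclNorm_sq (x : Lattice d) : euclNorm x ^ 2 = ∑ i, (x i : ℝ) ^ 2 :=
  Real.sq_sqrt (Finset.sum_nonneg fun _ _ => sq_nonneg _)

@[simp] lemma euclNorm_zero : euclNorm (0 : Lattice d) = 0 := by simp [euclNorm]

lemma euclNorm_eq_norm (x : Lattice d) :
    euclNorm x = ‖(WithLp.toLp 2 fun i => (x i : ℝ) : EuclideanSpace ℝ (Fin d))‖ := by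
  rw [EuclideanSpace.norm_eq]
  simp [euclNorm]

lemma euclNorm_add_le (x y : Lattice d) : euclNorm (x + y) ≤ euclNorm x + euclNorm y := by
  simp only [euclNorm_eq_norm]
  refine le_trans (le_of_eq ?_) (norm_add_le _ _)
  congr 1
  ext i
  simp

lemma euclNorm_neg (x : Lattice d) : euclNorm (-x) = euclNorm x := by
  simp [euclNorm]

lemma euclNorm_toVec (s : Step d) : euclNorm s.toVec = 1 := by
  obtain ⟨i, b⟩ := s
  have : ∀ j, ((Step.toVec (i, b) j : ℤ) : ℝ) ^ 2 = if j = i then 1 else 0 := by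
    intro j
    by_cases h : j = i
    · subst h; cases b <;> simp [Step.toVec]
    · simp [Step.toVec, h]
  simp [euclNorm, this]

lemma euclNorm_sub_le_add (x y z : Lattice d) :
    euclNorm (x - z) ≤ euclNorm (y - z) + euclNorm (x - y) := by
  have := euclNorm_add_le (y - z) (x - y)
  rwa [show y - z + (x - y) = x - z by abel] at this

lemma euclNorm_sub_comm (x y : Lattice d) : euclNorm (x - y) = euclNorm (y - x) := by
  rw [← euclNorm_neg, neg_sub]

lemma euclNorm_add_single_sq (v : Lattice d) (i : Fin d) (e : ℤ) :
    euclNorm (v + Pi.single i e) ^ 2 = euclNorm v ^ 2 + 2 * v i * e + (e : ℝ) ^ 2 := by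
  simp only [euclNorm_sq]
  rw [← Finset.add_sum_erase univ _ (Finset.mem_univ i),
    ← Finset.add_sum_erase univ (fun j => (v j : ℝ) ^ 2) (Finset.mem_univ i)]
  have : ∑ j ∈ univ.erase i, (((v + Pi.single i e : Lattice d) j : ℤ) : ℝ) ^ 2 =
      ∑ j ∈ univ.erase i, (v j : ℝ) ^ 2 := by
    refine Finset.sum_congr rfl fun j hj => ?_
    rw [Pi.add_apply, Pi.single_eq_of_ne (Finset.ne_of_mem_erase hj), add_zero]
  rw [this]
  simp
  ring

/-- The squared distance to a fixed site grows by exactly one on average in each step. -/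
lemma stepAvg_euclNorm_sq [NeZero d] (x y : Lattice d) :
    stepAvg (fun y => euclNorm (y - x) ^ 2) y = euclNorm (y - x) ^ 2 + 1 := by
  have hd : (d : ℝ) ≠ 0 := Nat.cast_ne_zero.2 (NeZero.ne d)
  unfold stepAvg
  rw [sum_step (fun v => euclNorm (y + v - x) ^ 2)]
  have : ∀ i : Fin d, euclNorm (y + Pi.single i 1 - x) ^ 2 + euclNorm (y + Pi.single i (-1) - x) ^ 2
      = 2 * (euclNorm (y - x) ^ 2 + 1) := by
    intro i
    rw [add_sub_right_comm, add_sub_right_comm, euclNorm_add_single_sq, euclNorm_add_single_sq]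
    push_cast
    ring
  simp only [this]
  simp
  field_simp

/-! ### Harmonic functions on finite sets -/

/-- The maximum principle for functions that are harmonic on a finite set. -/
lemma le_of_harmonic_of_boundary_le [NeZero d] {D : Finset (Lattice d)} {U : Lattice d → ℝ} {c : ℝ}
    (hU : ∀ x ∈ D, U x = stepAvg U x)
    (hb : ∀ x ∈ D, ∀ s : Step d, x + s.toVec ∉ D → U (x + s.toVec) ≤ c) :
    ∀ x ∈ D, U x ≤ c := by
  by_contra! hcon
  obtain ⟨x₁, hx₁, hcx₁⟩ := hcon
  obtain ⟨x₀, hx₀, hmax⟩ := D.exists_max_image U ⟨x₁, hx₁⟩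
  have hM : c < U x₀ := hcx₁.trans_le (hmax x₁ hx₁)
  have hne : (D.filter fun x => U x = U x₀).Nonempty := ⟨x₀, by simp [hx₀]⟩
  -- among the maximizers the one with the largest first coordinate has a neighbour above it
  obtain ⟨x, hx, hfar⟩ := exists_max_image _ (fun x : Lattice d => x 0) hne
  rw [Finset.mem_filter] at hx
  have hle : ∀ s : Step d, U (x + s.toVec) ≤ U x := by
    intro s
    by_cases hs : x + s.toVec ∈ D
    · rw [hx.2]; exact hmax _ hs
    · rw [hx.2]; exact (hb x hx.1 s hs).trans hM.le
  have hsum : ∑ s : Step d, U (x + s.toVec) = ∑ _s : Step d, U x := by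
    have h1 := hU x hx.1
    have h2 := stepAvg_const (U x) x
    have hd : (2 * d : ℝ) ≠ 0 := mul_ne_zero two_ne_zero (Nat.cast_ne_zero.2 (NeZero.ne d))
    have h3 := h2.trans h1
    unfold stepAvg at h3
    exact ((div_left_inj' hd).1 h3).symm
  have heq := (Finset.sum_eq_sum_iff_of_le fun s _ => hle s).1 hsum ((0 : Fin d), true)
    (Finset.mem_univ _)
  have hmem : x + Step.toVec ((0 : Fin d), true) ∈ D := by
    by_contra hs
    have := hb x hx.1 _ hs
    rw [heq, hx.2] at this
    exact absurd this (not_le.2 hM)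
  have := hfar _ (Finset.mem_filter.2 ⟨hmem, heq.trans hx.2⟩)
  simp [Step.toVec] at this

/-- The functions `x ↦ E_x[f(X_τ); τ ≤ n]`, where `τ` is the first time that a simple random walk
started at `x` is outside `A`. -/
noncomputable def exitValue (A : Finset (Lattice d)) (f : Lattice d → ℝ) : ℕ → Lattice d → ℝ
  | 0 => fun x => if x ∈ A then 0 else f x
  | n + 1 => fun x => if x ∈ A then stepAvg (exitValue A f n) x else f x

/-- Solvability of the Dirichlet problem on `A` with boundary values `f`. -/
lemma exists_dirichlet_solution [NeZero d] (A : Finset (Lattice d)) {f : Lattice d → ℝ} {C : ℝ}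
    (hf0 : ∀ x, 0 ≤ f x) (hfC : ∀ x, f x ≤ C) :
    ∃ U : Lattice d → ℝ, (∀ x, 0 ≤ U x) ∧ (∀ x, U x ≤ C) ∧ (∀ x ∉ A, U x = f x) ∧
      ∀ x ∈ A, U x = stepAvg U x := by
  have hC : 0 ≤ C := (hf0 0).trans (hfC 0)
  have h0 : ∀ n x, 0 ≤ exitValue A f n x := by
    intro n
    induction n with
    | zero => intro x; simp only [exitValue]; split_ifs; exacts [le_rfl, hf0 x]
    | succ n ih =>
      intro x; simp only [exitValue]; split_ifs
      · exact div_nonneg (Finset.sum_nonneg fun s _ => ih _) (by positivity)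
      · exact hf0 x
  have hle : ∀ n x, exitValue A f n x ≤ C := by
    intro n
    induction n with
    | zero => intro x; simp only [exitValue]; split_ifs; exacts [hC, hfC x]
    | succ n ih =>
      intro x; simp only [exitValue]; split_ifs
      · exact (stepAvg_mono fun s => ih _).trans (stepAvg_const C x).le
      · exact hfC x
  have hstep : ∀ n x, exitValue A f n x ≤ exitValue A f (n + 1) x := by
    intro n
    induction n with
    | zero =>
      intro x; simp only [exitValue]; split_ifs
      · exact div_nonneg (Finset.sum_nonneg fun s _ => h0 0 _) (by positivity)
      · exact le_rfl
    | succ n ih =>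
      intro x; rw [exitValue, exitValue]; beta_reduce; split_ifs
      · exact stepAvg_mono fun s => ih _
      · exact le_rfl
  have hlim : ∀ x, Filter.Tendsto (fun n => exitValue A f n x) Filter.atTop
      (nhds (⨆ n, exitValue A f n x)) := fun x =>
    tendsto_atTop_ciSup (monotone_nat_of_le_succ fun n => hstep n x)
      ⟨C, by rintro _ ⟨n, rfl⟩; exact hle n x⟩
  refine ⟨fun x => ⨆ n, exitValue A f n x, fun x => Real.iSup_nonneg fun n => h0 n x,
    fun x => ciSup_le fun n => hle n x, fun x hx => ?_, fun x hx => ?_⟩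
  · have : ∀ n, exitValue A f n x = f x := by
      intro n; cases n <;> simp [exitValue, hx]
    simp [this]
  · have h1 := (hlim x).comp (Filter.tendsto_add_atTop_nat 1)
    have h2 : Filter.Tendsto (fun n => stepAvg (exitValue A f n) x) Filter.atTop
        (nhds (stepAvg (fun y => ⨆ n, exitValue A f n y) x)) := by
      unfold stepAvg
      exact (tendsto_finsetSum _ fun s _ => hlim _).div_const _
    refine tendsto_nhds_unique h1 (h2.congr fun n => ?_)
    simp [exitValue, hx]

/-- Run the walk from `x` for `t` steps or until it leaves `A ∩ B(x, ρ)`. If it stops at a site of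
`B(x, ρ)` outside `A`, the value of `U` is at most `a`, and otherwise it is at most `K`. The walk
leaves `B(x, ρ)` with probability at most `t / ρ ^ 2`, and it is still in `A ∩ B(x, ρ)` at time `t`
with probability at most the sum of `heat t`. The statement for general starting points `y` is what
the induction on `t` needs. -/
lemma harmonic_le_of_escape [NeZero d] {A : Finset (Lattice d)} {U : Lattice d → ℝ} {x : Lattice d}
    {ρ a K : ℝ} (hρ : 0 < ρ) (haK : a ≤ K) (hU : ∀ y ∈ A, U y = stepAvg U y)
    (hK : ∀ y, euclNorm (y - x) ≤ ρ + 1 → U y ≤ K)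
    (ha : ∀ y ∉ A, euclNorm (y - x) < ρ → U y ≤ a) (t : ℕ) :
    ∀ y, euclNorm (y - x) ≤ ρ + 1 →
      U y ≤ a + (K - a) * ((euclNorm (y - x) ^ 2 + t) / ρ ^ 2 +
        ∑ p ∈ A with euclNorm (p - x) < ρ, heat t (y - p)) := by
  have hKa : 0 ≤ K - a := sub_nonneg.2 haK
  -- the sites where the walk is stopped
  have hfrozen : ∀ (t : ℕ) (y : Lattice d), euclNorm (y - x) ≤ ρ + 1 →
      ¬ (y ∈ A ∧ euclNorm (y - x) < ρ) →
      U y ≤ a + (K - a) * ((euclNorm (y - x) ^ 2 + t) / ρ ^ 2 +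
        ∑ p ∈ A with euclNorm (p - x) < ρ, heat t (y - p)) := by
    intro t y hy hn
    have hs : 0 ≤ ∑ p ∈ A with euclNorm (p - x) < ρ, heat t (y - p) :=
      Finset.sum_nonneg fun _ _ => heat_nonneg _ _
    by_cases hyρ : euclNorm (y - x) < ρ
    · have := ha y (fun h => hn ⟨h, hyρ⟩) hyρ
      have : 0 ≤ (K - a) * ((euclNorm (y - x) ^ 2 + t) / ρ ^ 2 +
        ∑ p ∈ A with euclNorm (p - x) < ρ, heat t (y - p)) := by positivity
      linarith
    · have h1 : 1 ≤ (euclNorm (y - x) ^ 2 + t) / ρ ^ 2 := by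
        rw [one_le_div (by positivity)]
        have := pow_le_pow_left₀ hρ.le (not_lt.1 hyρ) 2
        have : (0 : ℝ) ≤ t := t.cast_nonneg
        linarith
      have h2 := mul_le_mul_of_nonneg_left (add_le_add h1 hs) hKa
      have := hK y hy
      linarith
  induction t with
  | zero =>
    intro y hy
    by_cases hD : y ∈ A ∧ euclNorm (y - x) < ρ
    · have hs : 1 ≤ ∑ p ∈ A with euclNorm (p - x) < ρ, heat 0 (y - p) := by
        have := Finset.single_le_sum (f := fun p => heat 0 (y - p))
          (fun p _ => heat_nonneg 0 (y - p))
          (Finset.mem_filter.2 hD : y ∈ A.filter fun p => euclNorm (p - x) < ρ)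
        simpa [heat] using this
      have h1 : 0 ≤ (euclNorm (y - x) ^ 2 + (0 : ℕ)) / ρ ^ 2 := by positivity
      have h2 := mul_le_mul_of_nonneg_left (add_le_add h1 hs) hKa
      have := hK y hy
      linarith
    · exact hfrozen 0 y hy hD
  | succ t ih =>
    intro y hy
    by_cases hD : y ∈ A ∧ euclNorm (y - x) < ρ
    · rw [hU y hD.1]
      have hnb : ∀ s : Step d, euclNorm (y + s.toVec - x) ≤ ρ + 1 := by
        intro s
        have := euclNorm_add_le (y - x) s.toVec
        rw [euclNorm_toVec, sub_add_eq_add_sub] at this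
        linarith [hD.2]
      refine (stepAvg_mono (h := fun y => a + (K - a) * ((euclNorm (y - x) ^ 2 + t) / ρ ^ 2 +
        ∑ p ∈ A with euclNorm (p - x) < ρ, heat t (y - p)))
        fun s => ih _ (hnb s)).trans (le_of_eq ?_)
      rw [stepAvg_add, stepAvg_const, stepAvg_const_mul, stepAvg_add, stepAvg_sum]
      have e1 : stepAvg (fun y => (euclNorm (y - x) ^ 2 + t) / ρ ^ 2) y =
          (euclNorm (y - x) ^ 2 + (t + 1 : ℕ)) / ρ ^ 2 := by
        have : (fun y : Lattice d => (euclNorm (y - x) ^ 2 + t) / ρ ^ 2) =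
            fun y => (ρ ^ 2)⁻¹ * (euclNorm (y - x) ^ 2 + t) := by
          funext y; rw [div_eq_inv_mul]
        rw [this, stepAvg_const_mul, stepAvg_add, stepAvg_const, stepAvg_euclNorm_sq]
        push_cast
        ring
      have e2 : ∀ p : Lattice d, stepAvg (fun y => heat t (y - p)) y = heat (t + 1) (y - p) := by
        intro p
        simp only [heat, stepAvg]
        congr 1
        exact Finset.sum_congr rfl fun s _ => by rw [add_sub_right_comm]
      simp only [e1, e2]
    · exact hfrozen (t + 1) y hy hD

/-- A set that fills only a small fraction `β` of a ball is left inside the ball with probability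
at least `1 / 2`. -/
lemma exists_escape_density (d : ℕ) [NeZero d] :
    ∃ β : ℝ, 0 < β ∧ ∀ (A : Finset (Lattice d)) (U : Lattice d → ℝ) (x : Lattice d) (w a K : ℝ),
      12 ≤ w → a ≤ K → (∀ y ∈ A, U y = stepAvg U y) →
      (∀ y, euclNorm (y - x) ≤ w / 4 + 1 → U y ≤ K) →
      (∀ y ∉ A, euclNorm (y - x) < w / 4 → U y ≤ a) →
      ((#{y ∈ A | euclNorm (y - x) < w / 4} : ℕ) : ℝ) ≤ β * w ^ d → U x ≤ (a + K) / 2 := by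
  obtain ⟨H, hH, hheat⟩ := exists_heat_le d
  refine ⟨1 / (4 * H * 12 ^ d), by positivity, fun A U x w a K hw haK hU hK ha hcard => ?_⟩
  -- in time `t` the walk leaves the ball of radius `w / 4` with probability at most `1 / 4`, and
  -- `12 ≤ w` makes sure that `t` is positive
  set t := ⌊(w / 4) ^ 2 / 4⌋₊ with ht
  have hw2 : (9 : ℝ) ≤ (w / 4) ^ 2 := by nlinarith
  have ht1 : (t : ℝ) ≤ (w / 4) ^ 2 / 4 := Nat.floor_le (by positivity)
  have ht2 : (w / 12) ^ 2 ≤ t := by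
    have := Nat.lt_floor_add_one ((w / 4) ^ 2 / 4)
    rw [← ht] at this
    nlinarith
  have ht0 : 0 < t := by
    have : (0 : ℝ) < t := by nlinarith
    exact_mod_cast this
  have hsq : w / 12 ≤ √t := Real.le_sqrt_of_sq_le ht2
  have hpt : ∀ y : Lattice d, heat t y ≤ H / (w / 12) ^ d := by
    intro y
    rw [le_div_iff₀ (by positivity)]
    refine le_trans ?_ (hheat t y ht0)
    exact mul_le_mul_of_nonneg_left (pow_le_pow_left₀ (by positivity) hsq d) (heat_nonneg _ _)
  have hsum : ∑ p ∈ A with euclNorm (p - x) < w / 4, heat t (x - p) ≤ 1 / 4 := by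
    calc _ ≤ ∑ p ∈ A with euclNorm (p - x) < w / 4, H / (w / 12) ^ d :=
          Finset.sum_le_sum fun p _ => hpt _
      _ = (#{y ∈ A | euclNorm (y - x) < w / 4} : ℕ) * (H / (w / 12) ^ d) := by simp
      _ ≤ 1 / (4 * H * 12 ^ d) * w ^ d * (H / (w / 12) ^ d) := by gcongr
      _ = 1 / 4 := by
        have : w ≠ 0 := by positivity
        rw [div_pow]
        field_simp
  have hmain := harmonic_le_of_escape (by positivity : 0 < w / 4) haK hU hK ha t x
    (by simp; positivity)
  have h1 : (euclNorm (x - x) ^ 2 + t) / (w / 4) ^ 2 ≤ 1 / 4 := by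
    rw [sub_self, euclNorm_zero, div_le_iff₀ (by positivity)]
    linarith
  have := mul_le_mul_of_nonneg_left (add_le_add h1 hsum) (sub_nonneg.2 haK)
  linarith

/-! ### Shells and weights -/

/-- The weight of a site at distance `r` from the centre, relative to the shell `I = (lo, w)` of
inner radius `lo` and width `w`: sites closer to the centre than the shell are rewarded, sites in
the shell are penalized. The values satisfy `(1 / 2 + 3 / 2) / 2 = 1`, which makes the weight a
supermartingale when a walk stops in the shell with probability `1 / 2`. -/
noncomputable def shellWeight (I : ℕ × ℕ) (r : ℝ) : ℝ :=
  if r < I.1 then 3 / 2 else if r < I.1 + I.2 then 1 / 2 else 1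

/-- The product of the weights of a site `y` relative to all shells of the family `𝓘` around
`z`. -/
noncomputable def weight (z : Lattice d) (𝓘 : Finset (ℕ × ℕ)) (y : Lattice d) : ℝ :=
  ∏ I ∈ 𝓘, shellWeight I (euclNorm (y - z))

/-- The half-open intervals `[lo, lo + w)` of the family `𝓘` are pairwise disjoint. -/
def DisjointShells (𝓘 : Finset (ℕ × ℕ)) : Prop :=
  ∀ I ∈ 𝓘, ∀ J ∈ 𝓘, I ≠ J → I.1 + I.2 ≤ J.1 ∨ J.1 + J.2 ≤ I.1

/-- The number of shells of the family `𝓘` whose middle radius exceeds `r`. -/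
noncomputable def depth (𝓘 : Finset (ℕ × ℕ)) (r : ℝ) : ℕ :=
  #{I ∈ 𝓘 | r < I.1 + I.2 / 2}

lemma shellWeight_pos (I : ℕ × ℕ) (r : ℝ) : 0 < shellWeight I r := by
  unfold shellWeight; split_ifs <;> norm_num

lemma shellWeight_le (I : ℕ × ℕ) (r : ℝ) :
    shellWeight I r ≤ if r < I.1 + I.2 / 2 then 3 / 2 else 1 := by
  have : (0 : ℝ) ≤ I.2 := Nat.cast_nonneg _
  unfold shellWeight
  split_ifs <;> first | (exfalso; linarith) | norm_num

lemma weight_pos (z : Lattice d) (𝓘 : Finset (ℕ × ℕ)) (y : Lattice d) : 0 < weight z 𝓘 y :=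
  Finset.prod_pos fun _ _ => shellWeight_pos _ _

lemma prod_shellWeight_le (𝓘 : Finset (ℕ × ℕ)) (r : ℝ) :
    ∏ I ∈ 𝓘, shellWeight I r ≤ (3 / 2) ^ depth 𝓘 r := by
  refine (Finset.prod_le_prod (fun _ _ => (shellWeight_pos _ _).le)
    fun I _ => shellWeight_le I r).trans (le_of_eq ?_)
  rw [Finset.prod_ite, Finset.prod_const, Finset.prod_const_one, mul_one, depth]

lemma depth_le_card (𝓘 : Finset (ℕ × ℕ)) (r : ℝ) : depth 𝓘 r ≤ #𝓘 := Finset.card_filter_le _ _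

lemma weight_le (z : Lattice d) (𝓘 : Finset (ℕ × ℕ)) (y : Lattice d) :
    weight z 𝓘 y ≤ (3 / 2) ^ #𝓘 :=
  (prod_shellWeight_le 𝓘 _).trans (pow_le_pow_right₀ (by norm_num) (depth_le_card _ _))

lemma depth_erase {𝓘 : Finset (ℕ × ℕ)} {I : ℕ × ℕ} (hI : I ∈ 𝓘) (r : ℝ) :
    depth 𝓘 r = depth (𝓘.erase I) r + if r < I.1 + I.2 / 2 then 1 else 0 := by
  unfold depth
  conv_lhs => rw [← Finset.insert_erase hI]
  rw [Finset.filter_insert]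
  split_ifs with h
  · rw [Finset.card_insert_of_notMem (by simp)]
  · rfl

/-- Two radii in the same shell are on the same side of every other shell. -/
lemma depth_erase_congr {𝓘 : Finset (ℕ × ℕ)} (h𝓘 : DisjointShells 𝓘) {I : ℕ × ℕ} (hI : I ∈ 𝓘)
    {r r' : ℝ} (h1 : I.1 ≤ r) (h2 : r < I.1 + I.2) (h1' : I.1 ≤ r') (h2' : r' < I.1 + I.2) :
    depth (𝓘.erase I) r = depth (𝓘.erase I) r' := by
  unfold depth
  congr 1
  refine Finset.filter_congr fun J hJ => ?_
  rw [Finset.mem_erase] at hJ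
  have : (0 : ℝ) ≤ J.2 := Nat.cast_nonneg _
  rcases h𝓘 I hI J hJ.2 hJ.1.symm with h | h
  · have h : (I.1 + I.2 : ℝ) ≤ J.1 := by exact_mod_cast h
    exact ⟨fun _ => by linarith, fun _ => by linarith⟩
  · have h : (J.1 + J.2 : ℝ) ≤ I.1 := by exact_mod_cast h
    exact ⟨fun _ => by linarith, fun _ => by linarith⟩

/-- The key estimate: if the finite set `A` is thin in each shell, then the weight of the site at
which a walk started outside the middle of every shell leaves `A` has mean at most one. A walk that
gets to the middle of a shell leaves `A` inside that shell with probability at least `1 / 2`, which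
makes up for the reward it gets when it passes. -/
lemma exists_thin_density (d : ℕ) [NeZero d] :
    ∃ β : ℝ, 0 < β ∧ ∀ (A : Finset (Lattice d)) (z : Lattice d) (𝓘 : Finset (ℕ × ℕ))
      (U : Lattice d → ℝ), DisjointShells 𝓘 → (∀ I ∈ 𝓘, 12 ≤ I.2) →
      (∀ I ∈ 𝓘, ((#{y ∈ A | (I.1 : ℝ) ≤ euclNorm (y - z) ∧ euclNorm (y - z) < I.1 + I.2} : ℕ) : ℝ)
        ≤ β * (I.2 : ℝ) ^ d) →
      (∀ y, U y ≤ (3 / 2) ^ #𝓘) → (∀ y ∉ A, U y = weight z 𝓘 y) →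
      (∀ y ∈ A, U y = stepAvg U y) → ∀ k x, depth 𝓘 (euclNorm (x - z)) ≤ k →
        U x ≤ (3 / 2) ^ k := by
  obtain ⟨β, hβ, hesc⟩ := exists_escape_density d
  refine ⟨β, hβ, fun A z 𝓘 U hdis hw hthin hUC hUA hUh => ?_⟩
  -- downward induction on `k`, starting from the trivial bound for `k = #𝓘`
  suffices H : ∀ n k, #𝓘 ≤ k + n → ∀ x, depth 𝓘 (euclNorm (x - z)) ≤ k → U x ≤ (3 / 2) ^ k from
    fun k => H #𝓘 k (by omega)
  intro n
  induction n with
  | zero =>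
    intro k hk x _
    exact (hUC x).trans (pow_le_pow_right₀ (by norm_num) (by omega))
  | succ n ih =>
    intro k hk
    have hnext := ih (k + 1) (by omega)
    have hout : ∀ y ∉ A, depth 𝓘 (euclNorm (y - z)) ≤ k → U y ≤ (3 / 2) ^ k := by
      intro y hy hc
      rw [hUA y hy]
      exact (prod_shellWeight_le 𝓘 _).trans (pow_le_pow_right₀ (by norm_num) hc)
    have hmem : ∀ x ∈ A.filter fun x => depth 𝓘 (euclNorm (x - z)) ≤ k, U x ≤ (3 / 2) ^ k := by
      refine le_of_harmonic_of_boundary_le (fun x hx => hUh x (Finset.mem_filter.1 hx).1) ?_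
      intro x hx s hs
      set y := x + s.toVec with hy
      rw [Finset.mem_filter] at hx hs
      by_cases hyk : depth 𝓘 (euclNorm (y - z)) ≤ k
      · exact hout y (fun h => hs ⟨h, hyk⟩) hyk
      -- the step from `x` to `y` crosses the middle of a shell `I`
      obtain ⟨I, hI, hyI, hxI⟩ : ∃ I ∈ 𝓘, euclNorm (y - z) < I.1 + I.2 / 2 ∧
          ¬ euclNorm (x - z) < I.1 + I.2 / 2 := by
        by_contra! hcon
        refine hyk ((Finset.card_le_card fun I hI => ?_).trans hx.2)
        rw [Finset.mem_filter] at hI ⊢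
        exact ⟨hI.1, hcon I hI.1 hI.2⟩
      have hwI : (12 : ℝ) ≤ I.2 := by exact_mod_cast hw I hI
      have hxy : euclNorm (x - y) = 1 := by
        rw [euclNorm_sub_comm, hy, add_sub_cancel_left, euclNorm_toVec]
      have hmid := euclNorm_sub_le_add x y z
      have hin : ∀ y', euclNorm (y' - y) ≤ (I.2 : ℝ) / 4 + 1 →
          (I.1 : ℝ) ≤ euclNorm (y' - z) ∧ euclNorm (y' - z) < I.1 + I.2 := by
        intro y' hy'
        have e1 := euclNorm_sub_le_add y' y z
        have e2 := euclNorm_sub_le_add y y' z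
        rw [euclNorm_sub_comm y y'] at e2
        constructor <;> linarith
      have hd0 := hin y (by simp; linarith)
      have hdx := hin x (by linarith)
      have hcongr : ∀ y', euclNorm (y' - y) ≤ (I.2 : ℝ) / 4 + 1 →
          depth (𝓘.erase I) (euclNorm (y' - z)) = depth (𝓘.erase I) (euclNorm (y - z)) :=
        fun y' hy' => depth_erase_congr hdis hI (hin y' hy').1 (hin y' hy').2 hd0.1 hd0.2
      have hk0 : depth (𝓘.erase I) (euclNorm (y - z)) ≤ k := by
        rw [← hcongr x (by linarith)]
        have := depth_erase hI (euclNorm (x - z))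
        have := hx.2
        omega
      have hpow : (0 : ℝ) < (3 / 2) ^ k := by positivity
      have key := hesc A U y I.2 (1 / 2 * (3 / 2) ^ k) ((3 / 2) ^ (k + 1)) hwI
        (by rw [pow_succ]; linarith) hUh ?_ ?_ ?_
      · refine key.trans (le_of_eq ?_)
        rw [pow_succ]; ring
      · intro y' hy'
        refine hnext y' ?_
        rw [depth_erase hI, hcongr y' hy']
        split_ifs <;> omega
      · intro y' hy'A hy'
        have hs := hin y' (by linarith)
        rw [hUA y' hy'A, weight, ← Finset.mul_prod_erase 𝓘 _ hI]
        refine mul_le_mul (le_of_eq ?_) ((prod_shellWeight_le _ _).trans ?_)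
          (Finset.prod_nonneg fun _ _ => (shellWeight_pos _ _).le) (by norm_num)
        · rw [shellWeight, if_neg (not_lt.2 hs.1), if_pos hs.2]
        · rw [hcongr y' (by linarith)]
          exact pow_le_pow_right₀ (by norm_num) hk0
      · refine le_trans ?_ (hthin I hI)
        rw [Nat.cast_le]
        refine Finset.card_le_card fun p hp => ?_
        rw [Finset.mem_filter] at hp ⊢
        exact ⟨hp.1, hin p (by linarith [hp.2])⟩
    intro x hx
    by_cases hxA : x ∈ A
    · exact hmem x (Finset.mem_filter.2 ⟨hxA, hx⟩)
    · exact hout x hxA hx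

/-! ### Independence of the particles -/

/-- The σ-algebra generated by the steps with index in `S`. -/
abbrev stepSigma (d : ℕ) (S : Set (ℕ × ℕ)) : MeasurableSpace (Sample d) :=
  ⨆ i ∈ S, MeasurableSpace.comap (fun ω => ω i) inferInstance

instance : MeasurableSpace (Finset (Lattice d)) := ⊤

instance : DiscreteMeasurableSpace (Finset (Lattice d)) := ⟨fun _ => trivial⟩

instance [NeZero d] : IsProbabilityMeasure (prob d) := by
  unfold prob; infer_instance

lemma measurable_coord {S : Set (ℕ × ℕ)} {i : ℕ × ℕ} (hi : i ∈ S) :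
    Measurable[stepSigma d S] fun ω : Sample d => ω i :=
  measurable_iff_comap_le.2 (le_iSup₂_of_le i hi le_rfl)

lemma stepSigma_mono {S T : Set (ℕ × ℕ)} (h : S ⊆ T) : stepSigma d S ≤ stepSigma d T :=
  biSup_mono h

lemma stepSigma_le (S : Set (ℕ × ℕ)) : stepSigma d S ≤ MeasurableSpace.pi :=
  iSup₂_le fun i _ => measurable_iff_comap_le.1 (measurable_pi_apply i)

/-- Variables that depend on disjoint sets of steps can be integrated one after the other. -/
lemma lintegral_of_disjoint_steps [NeZero d] {α β : Type*} [MeasurableSpace α] [MeasurableSpace β]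
    {S T : Set (ℕ × ℕ)} (hST : Disjoint S T) {X : Sample d → α} {Y : Sample d → β}
    (hX : Measurable[stepSigma d S] X) (hY : Measurable[stepSigma d T] Y)
    {F : α × β → ℝ≥0∞} (hF : Measurable F) :
    ∫⁻ ω, F (X ω, Y ω) ∂prob d = ∫⁻ ω, ∫⁻ ω', F (X ω, Y ω') ∂prob d ∂prob d := by
  have hX' : Measurable X := hX.mono (stepSigma_le S) le_rfl
  have hY' : Measurable Y := hY.mono (stepSigma_le T) le_rfl
  have hcoord : iIndepFun (fun (i : ℕ × ℕ) (ω : Sample d) => ω i) (prob d) :=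
    iIndepFun_infinitePi (X := fun _ s => s) fun _ => measurable_id
  have hind : IndepFun X Y (prob d) :=
    indep_of_indep_of_le_right (indep_of_indep_of_le_left
      (indep_iSup_of_disjoint (fun i => measurable_iff_comap_le.1 (measurable_pi_apply i))
        hcoord hST) (measurable_iff_comap_le.1 hX)) (measurable_iff_comap_le.1 hY)
  have : IsProbabilityMeasure ((prob d).map Y) :=
    Measure.isProbabilityMeasure_map hY'.aemeasurable
  rw [← lintegral_map hF (hX'.prodMk hY'),
    (indepFun_iff_map_prod_eq_prod_map_map hX'.aemeasurable hY'.aemeasurable).1 hind,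
    lintegral_prod _ hF.aemeasurable, lintegral_map hF.lintegral_prod_right' hX']
  exact lintegral_congr fun ω => lintegral_map (hF.comp measurable_prodMk_left) hY'

lemma lintegral_coord [NeZero d] (i : ℕ × ℕ) (G : Step d → ℝ≥0∞) :
    ∫⁻ ω, G (ω i) ∂prob d = (∑ s, G s) / (2 * d) := by
  have hm : Measurable G := Measurable.of_discrete
  rw [← lintegral_map (f := G) (g := fun ω : Sample d => ω i) hm (measurable_pi_apply i)]
  unfold prob
  rw [show (fun ω : Sample d => ω i) = Function.eval i from rfl, Measure.infinitePi_map_eval,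
    lintegral_fintype, ENNReal.div_eq_inv_mul, Finset.mul_sum]
  refine Finset.sum_congr rfl fun s _ => ?_
  rw [PMF.toMeasure_apply_singleton _ _ (measurableSet_singleton s), PMF.uniformOfFintype_apply,
    mul_comm]
  simp [mul_comm]

/-! ### The exit site of a single particle -/

/-- The walk of particle `k`, stopped when it leaves `A`. -/
def stoppedWalk (ω : Sample d) (k : ℕ) (A : Finset (Lattice d)) : ℕ → Lattice d
  | 0 => 0
  | t + 1 => if stoppedWalk ω k A t ∈ A then stoppedWalk ω k A t + (ω (k, t)).toVec
      else stoppedWalk ω k A t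

lemma measurable_stoppedWalk (k : ℕ) (A : Finset (Lattice d)) (t : ℕ) :
    Measurable[stepSigma d {i | i.1 = k ∧ i.2 < t}] fun ω : Sample d => stoppedWalk ω k A t := by
  induction t with
  | zero => exact measurable_const
  | succ t ih =>
    have h1 := ih.mono (stepSigma_mono (d := d) (S := {i | i.1 = k ∧ i.2 < t})
      (T := {i | i.1 = k ∧ i.2 < t + 1}) fun i hi => ⟨hi.1, hi.2.trans (Nat.lt_succ_self t)⟩) le_rfl
    have h2 : Measurable[stepSigma d {i | i.1 = k ∧ i.2 < t + 1}] fun ω : Sample d => ω (k, t) :=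
      measurable_coord (by simp)
    exact (Measurable.of_discrete (f := fun p : Lattice d × Step d =>
      if p.1 ∈ A then p.1 + p.2.toVec else p.1)).comp (h1.prodMk h2)

lemma lintegral_stoppedWalk_succ [NeZero d] (k : ℕ) (A : Finset (Lattice d)) (t : ℕ)
    (F : Lattice d → ℝ≥0∞) :
    ∫⁻ ω, F (stoppedWalk ω k A (t + 1)) ∂prob d = ∫⁻ ω, (if stoppedWalk ω k A t ∈ A then
      (∑ s : Step d, F (stoppedWalk ω k A t + s.toVec)) / (2 * d)
      else F (stoppedWalk ω k A t)) ∂prob d := by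
  have h := lintegral_of_disjoint_steps (d := d) (S := {i | i.1 = k ∧ i.2 < t}) (T := {(k, t)})
    (by simp) (measurable_stoppedWalk k A t) (measurable_coord (Set.mem_singleton _))
    (F := fun p : Lattice d × Step d => F (if p.1 ∈ A then p.1 + p.2.toVec else p.1))
    Measurable.of_discrete
  refine h.trans (lintegral_congr fun ω => ?_)
  dsimp only
  split_ifs with hA
  · exact lintegral_coord (k, t) fun s => F (stoppedWalk ω k A t + s.toVec)
  · simp

lemma ofReal_stepAvg [NeZero d] {U : Lattice d → ℝ} (hU : ∀ x, 0 ≤ U x) (x : Lattice d) :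
    (∑ s : Step d, ENNReal.ofReal (U (x + s.toVec))) / (2 * d) = ENNReal.ofReal (stepAvg U x) := by
  have hd : (0 : ℝ) < 2 * d := mul_pos two_pos (Nat.cast_pos.2 (Nat.pos_of_ne_zero (NeZero.ne d)))
  rw [stepAvg, ENNReal.ofReal_div_of_pos hd, ENNReal.ofReal_sum_of_nonneg fun s _ => hU _]
  congr 1
  rw [ENNReal.ofReal_mul two_pos.le]
  simp

/-- A harmonic function of the stopped walk is a martingale. -/
lemma lintegral_harmonic_stoppedWalk [NeZero d] {A : Finset (Lattice d)} {U : Lattice d → ℝ}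
    (hU0 : ∀ x, 0 ≤ U x) (hU : ∀ x ∈ A, U x = stepAvg U x) (k t : ℕ) :
    ∫⁻ ω, ENNReal.ofReal (U (stoppedWalk ω k A t)) ∂prob d = ENNReal.ofReal (U 0) := by
  induction t with
  | zero => simp [stoppedWalk]
  | succ t ih =>
    rw [lintegral_stoppedWalk_succ k A t fun x => ENNReal.ofReal (U x), ← ih]
    refine lintegral_congr fun ω => ?_
    split_ifs with h
    · rw [ofReal_stepAvg hU0, ← hU _ h]
    · rfl

lemma euclNorm_stoppedWalk_le {A : Finset (Lattice d)} {r : ℝ} (hr : 0 ≤ r)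
    (hA : ∀ a ∈ A, euclNorm a ≤ r) (ω : Sample d) (k t : ℕ) :
    euclNorm (stoppedWalk ω k A t) ≤ r + 1 := by
  induction t with
  | zero => simp [stoppedWalk]; linarith
  | succ t ih =>
    rw [stoppedWalk]
    split_ifs with h
    · refine (euclNorm_add_le _ _).trans ?_
      rw [euclNorm_toVec]
      linarith [hA _ h]
    · exact ih

/-- The walk leaves a finite set almost surely: as long as it has not done so, its mean squared
distance from the origin grows by one in each step. -/
lemma ae_exists_stoppedWalk_notMem [NeZero d] (k : ℕ) (A : Finset (Lattice d)) :
    ∀ᵐ ω ∂prob d, ∃ t, stoppedWalk ω k A t ∉ A := by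
  obtain ⟨r, hr, hA⟩ : ∃ r : ℝ, 0 ≤ r ∧ ∀ a ∈ A, euclNorm a ≤ r :=
    ⟨∑ a ∈ A, euclNorm a, Finset.sum_nonneg fun _ _ => euclNorm_nonneg _,
      fun a ha => Finset.single_le_sum (f := euclNorm) (fun _ _ => euclNorm_nonneg _) ha⟩
  set p := prob d {ω | ¬ ∃ t, stoppedWalk ω k A t ∉ A} with hp
  have hgrow : ∀ t : ℕ, (t : ℝ≥0∞) * p ≤
      ∫⁻ ω, ENNReal.ofReal (euclNorm (stoppedWalk ω k A t) ^ 2) ∂prob d := by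
    intro t
    induction t with
    | zero => simp
    | succ t ih =>
      have hmeas : Measurable fun ω : Sample d => stoppedWalk ω k A t :=
        (measurable_stoppedWalk k A t).mono (stepSigma_le _) le_rfl
      have hset : MeasurableSet {ω : Sample d | stoppedWalk ω k A t ∈ A} :=
        hmeas (MeasurableSet.of_discrete (s := {x | x ∈ A}))
      have hpA : p ≤ ∫⁻ ω, {ω | stoppedWalk ω k A t ∈ A}.indicator 1 ω ∂prob d := by
        rw [lintegral_indicator_one hset]
        refine measure_mono fun ω hω => ?_
        by_contra h
        exact hω ⟨t, h⟩
      rw [lintegral_stoppedWalk_succ k A t fun x => ENNReal.ofReal (euclNorm x ^ 2)]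
      push_cast
      rw [add_mul, one_mul]
      refine (add_le_add ih hpA).trans ?_
      rw [← lintegral_add_right _ (measurable_one.indicator hset)]
      refine lintegral_mono fun ω => ?_
      by_cases h : stoppedWalk ω k A t ∈ A
      · have := stepAvg_euclNorm_sq 0 (stoppedWalk ω k A t)
        simp only [sub_zero] at this
        rw [if_pos h, ofReal_stepAvg (U := fun x => euclNorm x ^ 2) (fun x => sq_nonneg _), this,
          ENNReal.ofReal_add (sq_nonneg _) zero_le_one]
        simp [h]
      · simp [h]
  have hbd : ∀ t : ℕ, (t : ℝ≥0∞) * p ≤ ENNReal.ofReal ((r + 1) ^ 2) := by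
    intro t
    refine (hgrow t).trans ?_
    calc _ ≤ ∫⁻ _ω : Sample d, ENNReal.ofReal ((r + 1) ^ 2) ∂prob d := by
          refine lintegral_mono fun ω => ENNReal.ofReal_le_ofReal ?_
          exact pow_le_pow_left₀ (euclNorm_nonneg _) (euclNorm_stoppedWalk_le hr hA ω k t) 2
      _ = _ := by simp
  rw [ae_iff, ← hp]
  by_contra hne
  have hfin : p ≠ ∞ := measure_ne_top _ _
  obtain ⟨n, hn⟩ := ENNReal.exists_nat_mul_gt hne (ENNReal.ofReal_ne_top (r := (r + 1) ^ 2))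
  exact absurd (hbd n) (not_le.2 hn)

lemma stoppedWalk_eq_walk (ω : Sample d) (k : ℕ) (A : Finset (Lattice d)) (t : ℕ)
    (h : ∀ s < t, walk ω k s ∈ A) : stoppedWalk ω k A t = walk ω k t := by
  induction t with
  | zero => simp [stoppedWalk, walk]
  | succ t ih =>
    have ht := ih fun s hs => h s (hs.trans (Nat.lt_succ_self t))
    rw [stoppedWalk, ht, if_pos (h t (Nat.lt_succ_self t)), walk, walk, Finset.sum_range_succ]

lemma walk_exitTime_notMem {ω : Sample d} {k : ℕ} {A : Finset (Lattice d)}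
    (h : ∃ t, walk ω k t ∉ A) : walk ω k (exitTime ω k A) ∉ A :=
  Nat.sInf_mem (s := {t | walk ω k t ∉ A}) h

lemma walk_mem_of_lt_exitTime {ω : Sample d} {k t : ℕ} {A : Finset (Lattice d)}
    (h : t < exitTime ω k A) : walk ω k t ∈ A := by
  by_contra hn
  exact Nat.notMem_of_lt_sInf h hn

lemma stoppedWalk_eq_exit {ω : Sample d} {k : ℕ} {A : Finset (Lattice d)}
    (h : ∃ t, stoppedWalk ω k A t ∉ A) {t : ℕ} (ht : exitTime ω k A ≤ t) :
    stoppedWalk ω k A t = walk ω k (exitTime ω k A) ∧ walk ω k (exitTime ω k A) ∉ A := by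
  have hex : ∃ t, walk ω k t ∉ A := by
    by_contra! hcon
    obtain ⟨s, hs⟩ := h
    rw [stoppedWalk_eq_walk ω k A s fun s _ => hcon s] at hs
    exact hs (hcon s)
  have hnm := walk_exitTime_notMem hex
  refine ⟨?_, hnm⟩
  induction t, ht using Nat.le_induction with
  | base => exact stoppedWalk_eq_walk ω k A _ fun s hs => walk_mem_of_lt_exitTime hs
  | succ t _ ih => rw [stoppedWalk, ih, if_neg hnm]

/-- The site at which a walk leaves `A`, averaged with weight `f`, is governed by the solution of
the Dirichlet problem. -/
lemma lintegral_exit_le [NeZero d] {A : Finset (Lattice d)} {U f : Lattice d → ℝ}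
    (hU0 : ∀ x, 0 ≤ U x) (hU : ∀ x ∈ A, U x = stepAvg U x) (hUf : ∀ x ∉ A, U x = f x) (k : ℕ) :
    ∫⁻ ω, ENNReal.ofReal (f (walk ω k (exitTime ω k A))) ∂prob d ≤ ENNReal.ofReal (U 0) := by
  have hmeas : ∀ t, Measurable fun ω : Sample d => ENNReal.ofReal (U (stoppedWalk ω k A t)) :=
    fun t => (Measurable.of_discrete (f := fun x => ENNReal.ofReal (U x))).comp
      ((measurable_stoppedWalk k A t).mono (stepSigma_le _) le_rfl)
  calc _ ≤ ∫⁻ ω, Filter.liminf (fun t => ENNReal.ofReal (U (stoppedWalk ω k A t)))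
        Filter.atTop ∂prob d := by
        refine lintegral_mono_ae ?_
        filter_upwards [ae_exists_stoppedWalk_notMem k A] with ω hω
        refine le_of_eq (Filter.Tendsto.liminf_eq (tendsto_const_nhds.congr' ?_)).symm
        filter_upwards [Filter.eventually_ge_atTop (exitTime ω k A)] with t ht
        obtain ⟨h1, h2⟩ := stoppedWalk_eq_exit hω ht
        rw [h1, hUf _ h2]
    _ ≤ Filter.liminf (fun t => ∫⁻ ω, ENNReal.ofReal (U (stoppedWalk ω k A t)) ∂prob d)
        Filter.atTop := lintegral_liminf_le hmeas
    _ = ENNReal.ofReal (U 0) := by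
        simp only [lintegral_harmonic_stoppedWalk hU0 hU]
        exact Filter.liminf_const _

/-! ### Measurability of the cluster -/

/-- The first site outside `A` visited by the walk from the origin with steps `r`, and `0` if the
walk never leaves `A`. -/
noncomputable def exitSite (A : Finset (Lattice d)) (r : ℕ → Step d) : Lattice d :=
  ∑ s ∈ Finset.range (sInf {t : ℕ | ∑ s ∈ Finset.range t, (r s).toVec ∉ A}), (r s).toVec

lemma walk_exitTime_eq (ω : Sample d) (k : ℕ) (A : Finset (Lattice d)) :
    walk ω k (exitTime ω k A) = exitSite A fun t => ω (k, t) := rfl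

lemma sInf_setOf_eq_iff (p : ℕ → Prop) (n : ℕ) :
    sInf {t | p t} = n ↔ (p n ∧ ∀ m < n, ¬ p m) ∨ (n = 0 ∧ ∀ t, ¬ p t) := by
  constructor
  · rintro rfl
    by_cases h : ∃ t, p t
    · exact Or.inl ⟨Nat.sInf_mem (s := {t | p t}) h, fun m hm => Nat.notMem_of_lt_sInf hm⟩
    · push Not at h
      exact Or.inr ⟨by simp [h], h⟩
  · rintro (⟨h1, h2⟩ | ⟨rfl, h⟩)
    · refine le_antisymm (Nat.sInf_le h1) ?_
      by_contra! hlt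
      exact h2 _ hlt (Nat.sInf_mem (s := {t | p t}) ⟨n, h1⟩)
    · simp [h]

lemma measurable_exitSite (A : Finset (Lattice d)) : Measurable (exitSite A) := by
  have hS : ∀ t, Measurable fun r : ℕ → Step d => ∑ s ∈ Finset.range t, (r s).toVec := fun t =>
    Finset.measurable_fun_sum _ fun s _ =>
      (Measurable.of_discrete (f := Step.toVec)).comp (measurable_pi_apply s)
  have hmem : ∀ t, MeasurableSet {r : ℕ → Step d | ∑ s ∈ Finset.range t, (r s).toVec ∉ A} :=
    fun t => hS t (MeasurableSet.of_discrete (s := {x | x ∉ A}))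
  have hτ : Measurable fun r : ℕ → Step d =>
      sInf {t : ℕ | ∑ s ∈ Finset.range t, (r s).toVec ∉ A} := by
    refine measurable_to_countable' fun n => ?_
    have : (fun r : ℕ → Step d => sInf {t : ℕ | ∑ s ∈ Finset.range t, (r s).toVec ∉ A}) ⁻¹' {n} =
        ({r | ∑ s ∈ Finset.range n, (r s).toVec ∉ A} ∩
          ⋂ m : ℕ, ⋂ _ : m < n, {r | ∑ s ∈ Finset.range m, (r s).toVec ∉ A}ᶜ) ∪
        ({_r | n = 0} ∩ ⋂ t : ℕ, {r | ∑ s ∈ Finset.range t, (r s).toVec ∉ A}ᶜ) := by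
      ext r
      simp only [Set.mem_preimage, Set.mem_singleton_iff, Set.mem_union, Set.mem_inter_iff,
        Set.mem_iInter, Set.mem_compl_iff, Set.mem_ofPred_eq]
      exact sInf_setOf_eq_iff _ n
    rw [this]
    exact ((hmem n).inter (MeasurableSet.iInter fun m => MeasurableSet.iInter fun _ =>
      (hmem m).compl)).union ((MeasurableSet.const _).inter
        (MeasurableSet.iInter fun t => (hmem t).compl))
  have hj : Measurable fun p : (ℕ → Step d) × ℕ => ∑ s ∈ Finset.range p.2, (p.1 s).toVec :=
    measurable_from_prod_countable_left fun t => hS t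
  exact hj.comp (measurable_id.prodMk hτ)

lemma measurable_row (n : ℕ) :
    Measurable[stepSigma d {i | i.1 = n}] fun (ω : Sample d) (t : ℕ) => ω (n, t) :=
  @measurable_pi_lambda _ _ _ (stepSigma d {i | i.1 = n}) _ _ fun t =>
    measurable_coord (d := d) (S := {i | i.1 = n}) (i := (n, t)) rfl

lemma measurable_cluster (n : ℕ) :
    Measurable[stepSigma d {i | i.1 < n}] fun ω : Sample d => cluster ω n := by
  induction n with
  | zero => exact measurable_const
  | succ n ih =>
    have h1 := ih.mono (stepSigma_mono (d := d) (S := {i | i.1 < n}) (T := {i | i.1 < n + 1})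
      fun i hi => Nat.lt_succ_of_lt hi) le_rfl
    have h2 := (measurable_row (d := d) n).mono (stepSigma_mono (d := d) (S := {i | i.1 = n})
      (T := {i | i.1 < n + 1}) fun i hi => Nat.lt_succ_of_le (le_of_eq hi)) le_rfl
    have h3 : Measurable fun p : Finset (Lattice d) × (ℕ → Step d) =>
        insert (exitSite p.1 p.2) p.1 :=
      measurable_from_prod_countable_right fun B =>
        (Measurable.of_discrete (f := fun y => insert y B)).comp (measurable_exitSite B)
    simp only [cluster, walk_exitTime_eq]
    have h4 := h1.prodMk h2
    have h5 := h3.comp h4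
    exact h5

/-! ### The exponential supermartingale -/

/-- At most a fraction `β` of the scale `w ^ d` is occupied in every shell of the family. -/
def ThinInShells (β : ℝ) (z : Lattice d) (𝓘 : Finset (ℕ × ℕ)) (A : Finset (Lattice d)) : Prop :=
  ∀ I ∈ 𝓘, ((#{y ∈ A | (I.1 : ℝ) ≤ euclNorm (y - z) ∧ euclNorm (y - z) < I.1 + I.2} : ℕ) : ℝ)
    ≤ β * (I.2 : ℝ) ^ d

lemma ThinInShells.mono {β : ℝ} {z : Lattice d} {𝓘 : Finset (ℕ × ℕ)} {A B : Finset (Lattice d)}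
    (hAB : A ⊆ B) (h : ThinInShells β z 𝓘 B) : ThinInShells β z 𝓘 A := fun I hI =>
  le_trans (Nat.cast_le.2 (Finset.card_le_card (Finset.filter_subset_filter _ hAB))) (h I hI)

lemma weight_zero {z : Lattice d} {𝓘 : Finset (ℕ × ℕ)}
    (h : ∀ I ∈ 𝓘, ((I.1 + I.2 : ℕ) : ℝ) ≤ euclNorm z) : weight z 𝓘 0 = 1 := by
  refine Finset.prod_eq_one fun I hI => ?_
  have h1 := h I hI
  push_cast at h1
  have h2 : (0 : ℝ) ≤ I.2 := Nat.cast_nonneg _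
  rw [zero_sub, euclNorm_neg, shellWeight, if_neg (by linarith), if_neg (by linarith)]

open Classical in
/-- The total weight of a set that is thin in all shells, and zero for any other set. -/
noncomputable def totalWeight (β : ℝ) (z : Lattice d) (𝓘 : Finset (ℕ × ℕ))
    (A : Finset (Lattice d)) : ℝ≥0∞ :=
  if ThinInShells β z 𝓘 A then ENNReal.ofReal (∏ y ∈ A, weight z 𝓘 y) else 0

/-- The total weight of the cluster is a supermartingale. -/
lemma exists_lintegral_totalWeight_le (d : ℕ) [NeZero d] :
    ∃ β : ℝ, 0 < β ∧ ∀ (z : Lattice d) (𝓘 : Finset (ℕ × ℕ)), DisjointShells 𝓘 →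
      (∀ I ∈ 𝓘, 12 ≤ I.2) → (∀ I ∈ 𝓘, ((I.1 + I.2 : ℕ) : ℝ) ≤ euclNorm z) → ∀ n,
      ∫⁻ ω, totalWeight β z 𝓘 (cluster ω n) ∂prob d ≤ 1 := by
  obtain ⟨β, hβ, hmain⟩ := exists_thin_density d
  refine ⟨β, hβ, fun z 𝓘 hdis hw hz n => ?_⟩
  have hexit : ∀ (k : ℕ) (B : Finset (Lattice d)), ThinInShells β z 𝓘 B →
      ∫⁻ ω, ENNReal.ofReal (weight z 𝓘 (walk ω k (exitTime ω k B))) ∂prob d ≤ 1 := by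
    intro k B hB
    obtain ⟨U, hU0, hUC, hUB, hUh⟩ := exists_dirichlet_solution B
      (fun x => (weight_pos z 𝓘 x).le) (weight_le z 𝓘)
    refine (lintegral_exit_le hU0 hUh hUB k).trans (ENNReal.ofReal_le_one.2 ?_)
    have := hmain B z 𝓘 U hdis hw hB hUC hUB hUh 0 0 ?_
    · simpa using this
    · rw [Nat.le_zero, depth, Finset.card_eq_zero, Finset.filter_eq_empty_iff]
      intro I hI
      have h1 := hz I hI
      push_cast at h1
      have h2 : (0 : ℝ) ≤ I.2 := Nat.cast_nonneg _
      rw [zero_sub, euclNorm_neg]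
      linarith
  induction n with
  | zero =>
    calc _ ≤ ∫⁻ _ω : Sample d, 1 ∂prob d := by
          refine lintegral_mono fun ω => ?_
          unfold totalWeight
          split_ifs <;> simp [cluster]
      _ = 1 := by simp
  | succ n ih =>
    refine le_trans ?_ ih
    have hdisj : Disjoint {i : ℕ × ℕ | i.1 < n} {i | i.1 = n} :=
      Set.disjoint_left.2 fun i hi hi' => (ne_of_lt hi) hi'
    have hF : Measurable fun p : Finset (Lattice d) × (ℕ → Step d) =>
        totalWeight β z 𝓘 (insert (exitSite p.1 p.2) p.1) :=
      measurable_from_prod_countable_right fun B =>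
        (Measurable.of_discrete (f := fun y => totalWeight β z 𝓘 (insert y B))).comp
          (measurable_exitSite B)
    refine (lintegral_of_disjoint_steps hdisj (measurable_cluster n) (measurable_row n) hF).le.trans
      (lintegral_mono fun ω => ?_)
    dsimp only
    set B := cluster ω n
    by_cases hB : ThinInShells β z 𝓘 B
    · have hpt : ∀ ω' : Sample d, totalWeight β z 𝓘 (insert (exitSite B fun t => ω' (n, t)) B) ≤
          ENNReal.ofReal (∏ y ∈ B, weight z 𝓘 y) *
            ENNReal.ofReal (weight z 𝓘 (walk ω' n (exitTime ω' n B))) := by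
        intro ω'
        rw [← walk_exitTime_eq]
        set y := walk ω' n (exitTime ω' n B) with hy
        rw [← ENNReal.ofReal_mul (Finset.prod_nonneg fun _ _ => (weight_pos _ _ _).le)]
        rw [totalWeight]
        split_ifs
        · refine ENNReal.ofReal_le_ofReal (le_of_eq ?_)
          by_cases hyB : y ∈ B
          · -- the walk never leaves `B`, so that the exit time has its default value `0`
            have h0 : ¬ ∃ t, walk ω' n t ∉ B := fun h => walk_exitTime_notMem h hyB
            push Not at h0
            have : y = 0 := by
              have : exitTime ω' n B = 0 := by simp [exitTime, h0]
              rw [hy, this]; simp [walk]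
            rw [Finset.insert_eq_of_mem hyB, this, weight_zero hz, mul_one]
          · rw [Finset.prod_insert hyB, mul_comm]
        · exact zero_le
      calc _ ≤ ∫⁻ ω', ENNReal.ofReal (∏ y ∈ B, weight z 𝓘 y) *
            ENNReal.ofReal (weight z 𝓘 (walk ω' n (exitTime ω' n B))) ∂prob d :=
            lintegral_mono hpt
        _ = ENNReal.ofReal (∏ y ∈ B, weight z 𝓘 y) *
            ∫⁻ ω', ENNReal.ofReal (weight z 𝓘 (walk ω' n (exitTime ω' n B))) ∂prob d :=
            lintegral_const_mul' _ _ ENNReal.ofReal_ne_top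
        _ ≤ ENNReal.ofReal (∏ y ∈ B, weight z 𝓘 y) * 1 := by gcongr; exact hexit n B hB
        _ = _ := by rw [mul_one, totalWeight, if_pos hB]
    · have hpt : ∀ y, totalWeight β z 𝓘 (insert y B) = 0 := fun y =>
        if_neg fun h => hB (h.mono (Finset.subset_insert _ _))
      simp [hpt]

/-- The number of sites of `A` at distance less than `r` from `z`. -/
noncomputable def countBall (A : Finset (Lattice d)) (z : Lattice d) (r : ℕ) : ℕ :=
  #{y ∈ A | euclNorm (y - z) < r}

lemma card_shell (A : Finset (Lattice d)) (z : Lattice d) (I : ℕ × ℕ) :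
    #{y ∈ A | (I.1 : ℝ) ≤ euclNorm (y - z) ∧ euclNorm (y - z) < I.1 + I.2} =
      countBall A z (I.1 + I.2) - countBall A z I.1 := by
  have hsub : {y ∈ A | euclNorm (y - z) < (I.1 : ℝ)} ⊆
      {y ∈ A | euclNorm (y - z) < ((I.1 + I.2 : ℕ) : ℝ)} := by
    intro y hy
    rw [Finset.mem_filter] at hy ⊢
    refine ⟨hy.1, hy.2.trans_le ?_⟩
    push_cast
    linarith [(Nat.cast_nonneg I.2 : (0 : ℝ) ≤ I.2)]
  unfold countBall
  rw [← Finset.card_sdiff_of_subset hsub]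
  congr 1
  ext y
  simp only [Finset.mem_filter, Finset.mem_sdiff, not_and, not_lt]
  push_cast
  tauto

lemma prod_weight_eq (A : Finset (Lattice d)) (z : Lattice d) (𝓘 : Finset (ℕ × ℕ)) :
    ∏ y ∈ A, weight z 𝓘 y = ∏ I ∈ 𝓘, (3 / 2 : ℝ) ^ countBall A z I.1 *
      (1 / 2) ^ (countBall A z (I.1 + I.2) - countBall A z I.1) := by
  unfold weight
  rw [Finset.prod_comm]
  refine Finset.prod_congr rfl fun I _ => ?_
  simp only [shellWeight]
  rw [Finset.prod_ite, Finset.prod_const, Finset.prod_ite, Finset.prod_const,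
    Finset.prod_const_one, mul_one, ← card_shell, Finset.filter_filter, countBall]
  simp only [not_lt]

/-- A cluster that is thin in all shells, while many more sites lie within each shell than in it,
has large total weight and hence small probability. -/
lemma exists_prob_le_exp (d : ℕ) [NeZero d] :
    ∃ β : ℝ, 0 < β ∧ ∀ (z : Lattice d) (𝓘 : Finset (ℕ × ℕ)), DisjointShells 𝓘 →
      (∀ I ∈ 𝓘, 12 ≤ I.2) → (∀ I ∈ 𝓘, ((I.1 + I.2 : ℕ) : ℝ) ≤ euclNorm z) →
      ∀ (N : ℕ → ℕ), (∀ I ∈ 𝓘, ((N (I.1 + I.2) - N I.1 : ℕ) : ℝ) ≤ β * (I.2 : ℝ) ^ d) →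
      (∀ I ∈ 𝓘, 4 * (N (I.1 + I.2) - N I.1) ≤ N I.1) → ∀ n,
      (prob d).real {ω | ∀ I ∈ 𝓘, countBall (cluster ω n) z I.1 = N I.1 ∧
        countBall (cluster ω n) z (I.1 + I.2) = N (I.1 + I.2)} ≤
        Real.exp (-((∑ I ∈ 𝓘, N I.1 : ℕ) / 8 : ℝ)) := by
  obtain ⟨β, hβ, hmain⟩ := exists_lintegral_totalWeight_le d
  refine ⟨β, hβ, fun z 𝓘 hdis hw hz N hthin hfour n => ?_⟩
  set E := {ω : Sample d | ∀ I ∈ 𝓘, countBall (cluster ω n) z I.1 = N I.1 ∧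
    countBall (cluster ω n) z (I.1 + I.2) = N (I.1 + I.2)} with hE
  set G : ℝ := ((∑ I ∈ 𝓘, N I.1 : ℕ) : ℝ) / 8 with hG
  have hsub : E ⊆ {ω | ENNReal.ofReal (Real.exp G) ≤ totalWeight β z 𝓘 (cluster ω n)} := by
    intro ω hω
    have hthin' : ThinInShells β z 𝓘 (cluster ω n) := by
      intro I hI
      rw [card_shell, (hω I hI).1, (hω I hI).2]
      exact hthin I hI
    rw [Set.mem_ofPred_eq, totalWeight, if_pos hthin', prod_weight_eq]
    refine ENNReal.ofReal_le_ofReal ?_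
    rw [hG, Nat.cast_sum, Finset.sum_div, Real.exp_sum]
    refine Finset.prod_le_prod (fun _ _ => (Real.exp_pos _).le) fun I hI => ?_
    rw [(hω I hI).1, (hω I hI).2]
    set a := N (I.1 + I.2) - N I.1
    have ha : (4 : ℝ) * a ≤ N I.1 := by exact_mod_cast hfour I hI
    -- `log (3 / 2) - log 2 / 4` exceeds `1 / 8`
    have h32 : (1 / 3 : ℝ) ≤ Real.log (3 / 2) := by
      have := Real.one_sub_inv_le_log_of_pos (by norm_num : (0 : ℝ) < 3 / 2)
      norm_num at this ⊢
      linarith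
    have h12 : Real.log (1 / 2) = - Real.log 2 := by
      rw [one_div, Real.log_inv]
    have hlog2 := Real.log_two_lt_d9
    rw [← Real.log_le_log_iff (Real.exp_pos _) (by positivity), Real.log_exp,
      Real.log_mul (by positivity) (by positivity), Real.log_pow, Real.log_pow, h12]
    have h1 : (N I.1 : ℝ) * (1 / 3) ≤ N I.1 * Real.log (3 / 2) := by gcongr
    have h2 : (a : ℝ) * Real.log 2 ≤ a * 0.7 := by
      refine mul_le_mul_of_nonneg_left (by linarith) (Nat.cast_nonneg _)
    linarith
  have hmeas : Measurable fun ω : Sample d => totalWeight β z 𝓘 (cluster ω n) :=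
    (Measurable.of_discrete (f := totalWeight β z 𝓘)).comp
      ((measurable_cluster n).mono (stepSigma_le _) le_rfl)
  have hmk := (mul_meas_ge_le_lintegral hmeas (ENNReal.ofReal (Real.exp G))).trans
    (hmain z 𝓘 hdis hw hz n)
  have h1 : ENNReal.ofReal (Real.exp G) * prob d E ≤ 1 :=
    le_trans (mul_le_mul_right (measure_mono hsub) _) hmk
  have h2 := ENNReal.toReal_mono ENNReal.one_ne_top h1
  rw [ENNReal.toReal_mul, ENNReal.toReal_ofReal (Real.exp_pos _).le, ENNReal.toReal_one] at h2
  rw [Real.exp_neg, ← one_div, le_div_iff₀ (Real.exp_pos _), mul_comm]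
  exact h2

/-! ### Good shells in an interval of radii -/

/-- A family of disjoint shells between the radii `u` and `v`, each of them thin for the counting
function `N` and holding few sites compared with the ball that it encloses. -/
structure GoodShells (d : ℕ) (β : ℝ) (N : ℕ → ℕ) (u v : ℕ) (𝓘 : Finset (ℕ × ℕ)) : Prop where
  disjoint : DisjointShells 𝓘
  left_le : ∀ I ∈ 𝓘, u ≤ I.1
  le_right : ∀ I ∈ 𝓘, I.1 + I.2 ≤ v
  width : ∀ I ∈ 𝓘, 12 ≤ I.2
  thin : ∀ I ∈ 𝓘, ((N (I.1 + I.2) - N I.1 : ℕ) : ℝ) ≤ β * (I.2 : ℝ) ^ d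
  few : ∀ I ∈ 𝓘, 4 * (N (I.1 + I.2) - N I.1) ≤ N I.1

lemma GoodShells.empty (d : ℕ) (β : ℝ) (N : ℕ → ℕ) (u v : ℕ) : GoodShells d β N u v ∅ := by
  constructor <;> simp [DisjointShells]

lemma GoodShells.mono {β : ℝ} {N : ℕ → ℕ} {u v u' v' : ℕ} {𝓘 : Finset (ℕ × ℕ)}
    (h : GoodShells d β N u v 𝓘) (hu : u' ≤ u) (hv : v ≤ v') : GoodShells d β N u' v' 𝓘 :=
  ⟨h.disjoint, fun I hI => hu.trans (h.left_le I hI), fun I hI => (h.le_right I hI).trans hv,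
    h.width, h.thin, h.few⟩

lemma GoodShells.union {β : ℝ} {N : ℕ → ℕ} {u v w : ℕ} {𝓘 𝓙 : Finset (ℕ × ℕ)}
    (h : GoodShells d β N u v 𝓘) (h' : GoodShells d β N v w 𝓙) (huv : u ≤ v) (hvw : v ≤ w) :
    GoodShells d β N u w (𝓘 ∪ 𝓙) ∧
      ∑ I ∈ 𝓘 ∪ 𝓙, N I.1 = ∑ I ∈ 𝓘, N I.1 + ∑ I ∈ 𝓙, N I.1 := by
  have g := h.mono le_rfl hvw
  have g' := h'.mono huv le_rfl
  refine ⟨⟨?_, ?_, ?_, ?_, ?_, ?_⟩, Finset.sum_union (Finset.disjoint_left.2 fun I hI hI' => ?_)⟩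
  · intro I hI J hJ hne
    rcases Finset.mem_union.1 hI with hI | hI <;> rcases Finset.mem_union.1 hJ with hJ | hJ
    · exact h.disjoint I hI J hJ hne
    · exact Or.inl ((h.le_right I hI).trans (h'.left_le J hJ))
    · exact Or.inr ((h.le_right J hJ).trans (h'.left_le I hI))
    · exact h'.disjoint I hI J hJ hne
  · exact fun I hI => (Finset.mem_union.1 hI).elim (g.left_le I) (g'.left_le I)
  · exact fun I hI => (Finset.mem_union.1 hI).elim (g.le_right I) (g'.le_right I)
  · exact fun I hI => (Finset.mem_union.1 hI).elim (g.width I) (g'.width I)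
  · exact fun I hI => (Finset.mem_union.1 hI).elim (g.thin I) (g'.thin I)
  · exact fun I hI => (Finset.mem_union.1 hI).elim (g.few I) (g'.few I)
  · have h1 := h.le_right I hI
    have h2 := h'.left_le I hI'
    have h3 := h.width I hI
    omega

/-- Cut an interval of radii on which `N` varies by a factor at most `2 ^ d` into `q` shells of
width `w`. At least half of them are good, by Markov's inequality. -/
lemma exists_goodShells_of_width {β : ℝ} (hβ : 0 < β) {N : ℕ → ℕ} (hN : Monotone N)
    {u v M q w : ℕ} (huv : u + q * w ≤ v) (hM : 0 < M) (hMu : M ≤ N u) (hMv : N v ≤ 2 ^ d * M)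
    (hw : 12 ≤ w) (hq : 2 ^ (d + 4) ≤ q) (hqw : (2 : ℝ) ^ (d + 2) * M ≤ q * (β * (w : ℝ) ^ d)) :
    ∃ 𝓘, GoodShells d β N u v 𝓘 ∧ q * M ≤ 2 * ∑ I ∈ 𝓘, N I.1 := by
  classical
  set a : ℕ → ℕ := fun i => N (u + i * w + w) - N (u + i * w) with ha
  set κ : ℝ := β * (w : ℝ) ^ d with hκ
  have hκ0 : 0 < κ := by
    have : (0 : ℝ) < w := Nat.cast_pos.2 (by omega)
    positivity
  have hsum : ∑ i ∈ range q, a i ≤ 2 ^ d * M := by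
    have h1 : ∀ n, ∑ i ∈ range n, a i = N (u + n * w) - N u := by
      intro n
      induction n with
      | zero => simp
      | succ n ih =>
        have e1 : N u ≤ N (u + n * w) := hN (by omega)
        have e2 : N (u + n * w) ≤ N (u + n * w + w) := hN (by omega)
        rw [Finset.sum_range_succ, ih, ha, add_mul, one_mul, ← add_assoc]
        dsimp only
        omega
    rw [h1]
    exact (Nat.sub_le _ _).trans ((hN huv).trans hMv)
  have hsumR : ∑ i ∈ range q, (a i : ℝ) ≤ 2 ^ d * M := by exact_mod_cast hsum
  have hmarkov : ∀ c : ℝ, 0 < c → (2 : ℝ) ^ d * M ≤ q / 4 * c →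
      ((#{i ∈ range q | c < (a i : ℝ)} : ℕ) : ℝ) ≤ q / 4 := by
    intro c hc hle
    refine le_of_mul_le_mul_right ?_ hc
    calc ((#{i ∈ range q | c < (a i : ℝ)} : ℕ) : ℝ) * c
        = ∑ i ∈ range q with c < (a i : ℝ), c := by simp
      _ ≤ ∑ i ∈ range q with c < (a i : ℝ), (a i : ℝ) :=
        Finset.sum_le_sum fun i hi => (Finset.mem_filter.1 hi).2.le
      _ ≤ ∑ i ∈ range q, (a i : ℝ) :=
        Finset.sum_le_sum_of_subset_of_nonneg (Finset.filter_subset _ _)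
          fun _ _ _ => Nat.cast_nonneg _
      _ ≤ q / 4 * c := hsumR.trans hle
  have hB1 := hmarkov κ hκ0 (by
    rw [pow_add] at hqw
    linarith)
  have hB2 := hmarkov (M / 4) (by positivity) (by
    have : (2 : ℝ) ^ (d + 4) ≤ q := by exact_mod_cast hq
    rw [pow_add] at this
    have hM' : (0 : ℝ) < M := by exact_mod_cast hM
    nlinarith)
  set g := (range q).filter fun i => (a i : ℝ) ≤ κ ∧ (a i : ℝ) ≤ M / 4 with hg
  have hgcard : (q : ℝ) ≤ 2 * #g := by
    have hcover : range q ⊆ g ∪ ({i ∈ range q | κ < (a i : ℝ)} ∪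
        {i ∈ range q | (M / 4 : ℝ) < a i}) := by
      intro i hi
      simp only [hg, Finset.mem_union, Finset.mem_filter]
      by_cases h1 : (a i : ℝ) ≤ κ
      · by_cases h2 : (a i : ℝ) ≤ M / 4
        · exact Or.inl ⟨hi, h1, h2⟩
        · exact Or.inr (Or.inr ⟨hi, not_le.1 h2⟩)
      · exact Or.inr (Or.inl ⟨hi, not_le.1 h1⟩)
    have h1 := (Finset.card_le_card hcover).trans ((Finset.card_union_le _ _).trans
      (Nat.add_le_add_left (Finset.card_union_le _ _) _))
    rw [Finset.card_range] at h1
    have h2 : (q : ℝ) ≤ #g + (((#{i ∈ range q | κ < (a i : ℝ)} : ℕ) : ℝ) +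
        ((#{i ∈ range q | (M / 4 : ℝ) < a i} : ℕ) : ℝ)) := by exact_mod_cast h1
    linarith
  have hinj : Set.InjOn (fun i => (u + i * w, w)) (g : Set ℕ) := by
    intro i _ j _ hij
    have := (Prod.mk.inj hij).1
    exact Nat.eq_of_mul_eq_mul_right (by omega : 0 < w) (by omega)
  refine ⟨g.image fun i => (u + i * w, w), ⟨?_, ?_, ?_, ?_, ?_, ?_⟩, ?_⟩
  · intro I hI J hJ hne
    obtain ⟨i, _, rfl⟩ := Finset.mem_image.1 hI
    obtain ⟨j, _, rfl⟩ := Finset.mem_image.1 hJ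
    rcases lt_trichotomy i j with h | h | h
    · left
      have := Nat.mul_le_mul_right w (Nat.succ_le_of_lt h)
      rw [Nat.succ_mul] at this
      dsimp only; omega
    · exact absurd (by rw [h]) hne
    · right
      have := Nat.mul_le_mul_right w (Nat.succ_le_of_lt h)
      rw [Nat.succ_mul] at this
      dsimp only; omega
  · intro I hI
    obtain ⟨i, _, rfl⟩ := Finset.mem_image.1 hI
    exact Nat.le_add_right _ _
  · intro I hI
    obtain ⟨i, hi, rfl⟩ := Finset.mem_image.1 hI
    have := Finset.mem_range.1 (Finset.mem_filter.1 hi).1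
    have := Nat.mul_le_mul_right w (Nat.succ_le_of_lt this)
    rw [Nat.succ_mul] at this
    dsimp only; omega
  · intro I hI
    obtain ⟨i, _, rfl⟩ := Finset.mem_image.1 hI
    exact hw
  · intro I hI
    obtain ⟨i, hi, rfl⟩ := Finset.mem_image.1 hI
    exact (Finset.mem_filter.1 hi).2.1
  · intro I hI
    obtain ⟨i, hi, rfl⟩ := Finset.mem_image.1 hI
    have h1 := (Finset.mem_filter.1 hi).2.2
    have h2 : (4 * a i : ℝ) ≤ M := by linarith
    have h3 : 4 * a i ≤ M := by exact_mod_cast h2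
    exact h3.trans (hMu.trans (hN (Nat.le_add_right _ _)))
  · rw [Finset.sum_image hinj]
    have h1 : #g * M ≤ ∑ i ∈ g, N (u + i * w) := by
      rw [← smul_eq_mul]
      exact Finset.card_nsmul_le_sum _ _ _ fun i _ => hMu.trans (hN (Nat.le_add_right _ _))
    have h2 : q ≤ 2 * #g := by exact_mod_cast hgcard
    calc q * M ≤ 2 * #g * M := Nat.mul_le_mul_right _ h2
      _ = 2 * (#g * M) := by ring
      _ ≤ _ := Nat.mul_le_mul_left _ h1

/-- The constant that decides how many shells fit into an interval of radii. The first term makes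
the shells wide enough, the second one makes them thin on average. -/
noncomputable def levelConst (d : ℕ) (β : ℝ) : ℝ := 48 ^ d + 4 ^ (d + 1) / β

lemma one_le_levelConst {β : ℝ} (hβ : 0 < β) : 1 ≤ levelConst d β := by
  have h1 : (1 : ℝ) ≤ 48 ^ d := one_le_pow₀ (by norm_num)
  have h2 : (0 : ℝ) ≤ 4 ^ (d + 1) / β := by positivity
  unfold levelConst
  linarith

lemma add_sub_le_of_strict {N : ℕ → ℕ} {u v : ℕ} (hs : ∀ r, u ≤ r → r < v → N r < N (r + 1))
    (huv : u ≤ v) : N u + (v - u) ≤ N v := by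
  induction v, huv using Nat.le_induction with
  | base => simp
  | succ v hv ih =>
    have h1 := ih fun r h1 h2 => hs r h1 (by omega)
    have h2 := hs v hv (by omega)
    omega

/-- An interval of `t` radii on which `N` is between `M` and `2 ^ d * M` has room for `q` shells of
width `t / q`, provided that `M q ^ (d - 1)` is small compared with `t ^ d`. -/
lemma exists_goodShells_of_level (hd : 1 ≤ d) {β : ℝ} (hβ : 0 < β) {N : ℕ → ℕ} (hN : Monotone N)
    {u v M q : ℕ} (huv : u ≤ v) (hs : ∀ r, u ≤ r → r < v → N r < N (r + 1)) (hM : 0 < M)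
    (hMu : M ≤ N u) (hMv : N v ≤ 2 ^ d * M) (hq : 2 ^ (d + 4) ≤ q)
    (hC : levelConst d β * M * (q : ℝ) ^ (d - 1) ≤ ((v - u : ℕ) : ℝ) ^ d) :
    ∃ 𝓘, GoodShells d β N u v 𝓘 ∧ q * M ≤ 2 * ∑ I ∈ 𝓘, N I.1 := by
  obtain ⟨e, rfl⟩ : ∃ e, d = e + 1 := ⟨d - 1, by omega⟩
  rw [Nat.add_sub_cancel] at hC
  set t := v - u with ht
  have hq0 : 0 < q := lt_of_lt_of_le (by positivity) hq
  have hqR : (0 : ℝ) < q := by exact_mod_cast hq0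
  have hMR : (0 : ℝ) < M := by exact_mod_cast hM
  have hl1 : (48 : ℝ) ^ (e + 1) ≤ levelConst (e + 1) β := by
    have : (0 : ℝ) ≤ 4 ^ (e + 1 + 1) / β := by positivity
    unfold levelConst; linarith
  have hl2 : (4 : ℝ) ^ (e + 2) ≤ levelConst (e + 1) β * β := by
    have h1 : (0 : ℝ) ≤ 48 ^ (e + 1) * β := by positivity
    unfold levelConst
    rw [add_mul, div_mul_cancel₀ _ hβ.ne']
    linarith
  have htpos : 0 < t := by
    by_contra h
    have h0 : t = 0 := by omega
    rw [h0, Nat.cast_zero, zero_pow (by omega)] at hC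
    have := one_le_levelConst (d := e + 1) hβ
    have : 0 < levelConst (e + 1) β * M * (q : ℝ) ^ e := by positivity
    linarith
  have htR : (0 : ℝ) < t := by exact_mod_cast htpos
  have htM : (t : ℝ) ≤ 2 ^ (e + 1) * M := by
    have := (Nat.le_add_left _ _).trans ((add_sub_le_of_strict hs huv).trans hMv)
    exact_mod_cast this
  have h24 : 24 * (q : ℝ) ≤ t := by
    by_contra! hlt
    have h1 : (t : ℝ) ^ (e + 1) ≤ t * (24 * q) ^ e := by
      rw [pow_succ, mul_comm]
      exact mul_le_mul_of_nonneg_left (pow_le_pow_left₀ htR.le hlt.le e) htR.le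
    have h2 : (48 : ℝ) ^ (e + 1) * M * (q : ℝ) ^ e ≤ 2 ^ (e + 1) * M * (24 * q) ^ e := by
      calc _ ≤ levelConst (e + 1) β * M * (q : ℝ) ^ e := by gcongr
        _ ≤ t * (24 * q) ^ e := hC.trans h1
        _ ≤ _ := by gcongr
    have h3 : (2 : ℝ) ^ (e + 1) * M * (24 * q) ^ e * 24 = 48 ^ (e + 1) * M * (q : ℝ) ^ e := by
      rw [mul_pow, show (48 : ℝ) = 2 * 24 by norm_num, mul_pow, pow_succ (24 : ℝ) e]
      ring
    have h4 : 0 < (2 : ℝ) ^ (e + 1) * M * (24 * q) ^ e := by positivity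
    linarith
  have h24' : 24 * q ≤ t := by exact_mod_cast h24
  have hw24 : 24 ≤ t / q := (Nat.le_div_iff_mul_le hq0).2 h24'
  have hw2 : (t : ℝ) / (2 * q) ≤ (t / q : ℕ) := by
    have h1 := Nat.lt_div_mul_add (a := t) hq0
    have h2 : q ≤ t / q * q := Nat.le_mul_of_pos_left q (by omega)
    have h3 : t ≤ t / q * (2 * q) := by nlinarith
    rw [div_le_iff₀ (by positivity)]
    exact_mod_cast h3
  refine exists_goodShells_of_width hβ hN (w := t / q) ?_ hM hMu hMv (by omega) hq ?_
  · have := Nat.mul_div_le t q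
    omega
  · have h1 : ((t : ℝ) / (2 * q)) ^ (e + 1) ≤ ((t / q : ℕ) : ℝ) ^ (e + 1) :=
      pow_le_pow_left₀ (by positivity) hw2 _
    calc (2 : ℝ) ^ (e + 1 + 2) * M = 4 ^ (e + 2) * M / 2 ^ (e + 1) := by
          rw [eq_div_iff (by positivity), show (4 : ℝ) = 2 * 2 by norm_num, mul_pow]
          ring
      _ ≤ levelConst (e + 1) β * β * M / 2 ^ (e + 1) := by gcongr
      _ = q * (β * ((levelConst (e + 1) β * M * (q : ℝ) ^ e) / (2 * q) ^ (e + 1))) := by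
          rw [mul_pow, pow_succ (q : ℝ) e]
          field_simp
      _ ≤ q * (β * ((t : ℝ) ^ (e + 1) / (2 * q) ^ (e + 1))) := by gcongr
      _ ≤ _ := by rw [← div_pow]; gcongr

/-! ### Levels of the counting function -/

lemma exists_threshold {N : ℕ → ℕ} (hN : Monotone N) (X R : ℕ) :
    ∃ u ≤ R, ∀ r < R, N r < X ↔ r < u := by
  induction R with
  | zero => exact ⟨0, le_rfl, by simp⟩
  | succ R ih =>
    obtain ⟨u, hu, h⟩ := ih
    by_cases hX : N R < X
    · exact ⟨R + 1, le_rfl, fun r hr =>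
        ⟨fun _ => hr, fun _ => (hN (Nat.le_of_lt_succ hr)).trans_lt hX⟩⟩
    · refine ⟨u, by omega, fun r hr => ?_⟩
      rcases Nat.lt_succ_iff_lt_or_eq.1 hr with h1 | rfl
      · exact h r h1
      · exact ⟨fun h2 => absurd h2 hX, fun h2 => by omega⟩

/-- A cut of the radii below `R` into levels, on each of which the counting function `N` varies by
a factor less than `2 ^ d`. -/
lemma exists_levels (d : ℕ) {N : ℕ → ℕ} (hN : Monotone N) (R : ℕ) :
    ∃ u : ℕ → ℕ, Monotone u ∧ (∀ k, u k ≤ R) ∧ ∀ k, ∀ r < R, N r < 2 ^ (d * k) ↔ r < u k := by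
  choose u hu h using fun k => exists_threshold hN (2 ^ (d * k)) R
  refine ⟨u, monotone_nat_of_le_succ fun k => ?_, hu, h⟩
  by_contra! hlt
  have hR := hlt.trans_le (hu k)
  have h1 := (h k _ hR).2 hlt
  have h2 := (h (k + 1) _ hR).1 (h1.trans_le (Nat.pow_le_pow_right two_pos (by nlinarith)))
  exact lt_irrefl _ h2

lemma level_last_eq {N u : ℕ → ℕ} {R K : ℕ} (hs : ∀ r < R, N r < N (r + 1)) (hN : Monotone N)
    (huR : ∀ k, u k ≤ R) (hu : ∀ k, ∀ r < R, N r < 2 ^ (d * k) ↔ r < u k)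
    (hNR : N R ≤ 2 ^ (d * K)) : u K = R := by
  refine le_antisymm (huR K) ?_
  by_contra! hlt
  have h1 := (hs _ hlt).trans_le (hN (Nat.succ_le_of_lt hlt))
  exact lt_irrefl _ ((hu K _ hlt).1 (h1.trans_le hNR))

/-- The shells found in a single level, with the number `q` of shells to be chosen. -/
lemma exists_goodShells_of_levels (hd : 1 ≤ d) {β : ℝ} (hβ : 0 < β) {N u : ℕ → ℕ} {R k q : ℕ}
    (hs : ∀ r < R, N r < N (r + 1)) (hN : Monotone N) (huR : ∀ k, u k ≤ R)
    (hu : ∀ k, ∀ r < R, N r < 2 ^ (d * k) ↔ r < u k) (hlt : u k < u (k + 1))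
    (hq : 2 ^ (d + 4) ≤ q)
    (hC : levelConst d β * 2 ^ (d * k) * (q : ℝ) ^ (d - 1) ≤ ((u (k + 1) - 1 - u k : ℕ) : ℝ) ^ d) :
    ∃ 𝓘, GoodShells d β N (u k) (u (k + 1)) 𝓘 ∧ q * 2 ^ (d * k) ≤ 2 * ∑ I ∈ 𝓘, N I.1 := by
  have hR := huR (k + 1)
  have h1 : 2 ^ (d * k) ≤ N (u k) := by
    by_contra! h
    exact lt_irrefl _ ((hu k _ (hlt.trans_le hR)).1 h)
  have h2 : N (u (k + 1) - 1) ≤ 2 ^ d * 2 ^ (d * k) := by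
    have := (hu (k + 1) (u (k + 1) - 1) (by omega)).2 (by omega)
    rw [← pow_add, add_comm d, ← Nat.mul_succ]
    exact this.le
  obtain ⟨𝓘, h𝓘, hsum⟩ := exists_goodShells_of_level hd hβ hN (u := u k) (v := u (k + 1) - 1)
    (M := 2 ^ (d * k)) (q := q) (by omega) (fun r _ hr => hs r (by omega)) (by positivity) h1 h2 hq
    (by push_cast; exact hC)
  exact ⟨𝓘, h𝓘.mono le_rfl (by omega), hsum⟩

/-! ### Good shells in dimension two -/

/-- In dimension two a level of thickness `t` contributes a constant multiple of `t ^ 2`, once `t`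
is large compared with the square root of the number of sites. -/
lemma exists_goodShells_level_two {β : ℝ} (hβ : 0 < β) {N u : ℕ → ℕ} {R k : ℕ} {C₁ : ℝ}
    (hC₁ : 256 * levelConst 2 β ≤ C₁) (hs : ∀ r < R, N r < N (r + 1)) (hN : Monotone N)
    (huR : ∀ k, u k ≤ R)
    (hu : ∀ k, ∀ r < R, N r < 2 ^ (2 * k) ↔ r < u k) :
    ∃ 𝓘, GoodShells 2 β N (u k) (u (k + 1)) 𝓘 ∧
      (max (((u (k + 1) : ℝ) - u k) - C₁ * 2 ^ k) 0) ^ 2 / (32 * levelConst 2 β) ≤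
        (∑ I ∈ 𝓘, N I.1 : ℕ) := by
  set C := levelConst 2 β with hC
  have hC1 : 1 ≤ C := one_le_levelConst hβ
  set t : ℝ := (u (k + 1) : ℝ) - u k with ht
  have h2k : (1 : ℝ) ≤ 2 ^ k := one_le_pow₀ one_le_two
  have h4k : ((2 : ℝ) ^ k) ^ 2 = 2 ^ (2 * k) := by rw [← pow_mul, mul_comm]
  rcases le_total (t - C₁ * 2 ^ k) 0 with hbad | hgood
  · refine ⟨∅, GoodShells.empty _ _ _ _ _, ?_⟩
    rw [max_eq_right hbad]
    simp
  rw [max_eq_left hgood]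
  have hC₁k : C₁ ≤ C₁ * 2 ^ k := le_mul_of_one_le_right (by linarith) h2k
  have htbig : 256 ≤ t := by nlinarith
  have hlt : u k < u (k + 1) := by
    have : (u k : ℝ) < u (k + 1) := by linarith
    exact_mod_cast this
  set t' : ℕ := u (k + 1) - 1 - u k with ht'
  have htt' : (t' : ℝ) = t - 1 := by
    have : t' + 1 + u k = u (k + 1) := by omega
    have : (t' : ℝ) + 1 + u k = u (k + 1) := by exact_mod_cast this
    linarith
  have hhalf : t / 2 ≤ t' := by linarith
  set M : ℝ := 2 ^ (2 * k) with hM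
  have hMpos : 0 < M := by positivity
  have hCM : 0 < C * M := by positivity
  set q := ⌊(t' : ℝ) ^ 2 / (C * M)⌋₊ with hq
  have h64 : (64 : ℝ) ≤ (t' : ℝ) ^ 2 / (C * M) := by
    rw [le_div_iff₀ hCM]
    have h1 : 256 * C * 2 ^ k ≤ t := by
      have := mul_le_mul_of_nonneg_right hC₁ (zero_le_one.trans h2k)
      linarith
    have h2 : (128 * C * 2 ^ k) ^ 2 ≤ (t' : ℝ) ^ 2 :=
      pow_le_pow_left₀ (by positivity) (by linarith) 2
    have h3 : (128 * C * 2 ^ k) ^ 2 = 16384 * (C * (C * M)) := by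
      rw [mul_pow, h4k]; ring
    have h4 : C * M ≤ C * (C * M) := le_mul_of_one_le_left hCM.le hC1
    linarith
  have hq64 : 64 ≤ q := Nat.le_floor (by exact_mod_cast h64)
  have hq1 : (q : ℝ) ≤ (t' : ℝ) ^ 2 / (C * M) := Nat.floor_le (by positivity)
  have hq2 : (t' : ℝ) ^ 2 / (C * M) / 2 ≤ q := by
    have h1 := Nat.lt_floor_add_one ((t' : ℝ) ^ 2 / (C * M))
    linarith
  obtain ⟨𝓘, h𝓘, hsum⟩ := exists_goodShells_of_levels (d := 2) (by norm_num) hβ hs hN huR hu hlt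
    (q := q) (by norm_num; exact hq64) (by
      rw [le_div_iff₀ hCM] at hq1
      rw [← hC, ← ht', ← hM]
      simpa [mul_comm] using hq1)
  refine ⟨𝓘, h𝓘, ?_⟩
  have hsumR : (q : ℝ) * M ≤ 2 * (∑ I ∈ 𝓘, N I.1 : ℕ) := by
    rw [hM]; exact_mod_cast hsum
  have h1 : (t' : ℝ) ^ 2 / (2 * C) ≤ q * M := by
    calc (t' : ℝ) ^ 2 / (2 * C) = (t' : ℝ) ^ 2 / (C * M) / 2 * M := by field_simp
      _ ≤ _ := by gcongr
  have h2 : (t - C₁ * 2 ^ k) ^ 2 ≤ 4 * (t' : ℝ) ^ 2 := by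
    have : t - C₁ * 2 ^ k ≤ 2 * t' := by nlinarith
    calc (t - C₁ * 2 ^ k) ^ 2 ≤ (2 * (t' : ℝ)) ^ 2 := pow_le_pow_left₀ hgood this 2
      _ = _ := by ring
  have h3 : (t - C₁ * 2 ^ k) ^ 2 / (32 * C) ≤ (t' : ℝ) ^ 2 / (2 * C) / 2 := by
    rw [div_div, div_le_div_iff₀ (by positivity) (by positivity)]
    nlinarith
  linarith

/-- In dimension two all levels contribute. Since there are about `log R` of them, the
Cauchy-Schwarz inequality leaves `R ^ 2 / log R`. -/
lemma exists_goodShells_two {β : ℝ} (hβ : 0 < β) :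
    ∃ (e : ℕ) (c : ℝ), 0 < c ∧ ∀ (j : ℕ) (N : ℕ → ℕ), e ≤ j → 1 ≤ j → Monotone N →
      (∀ r < 2 ^ (2 * j), N r < N (r + 1)) → N (2 ^ (2 * j)) ≤ 2 ^ (2 * (2 * j - e)) →
      ∃ 𝓘, GoodShells 2 β N 0 (2 ^ (2 * j)) 𝓘 ∧
        c * (2 ^ (2 * j)) ^ 2 / j ≤ (∑ I ∈ 𝓘, N I.1 : ℕ) := by
  set C := levelConst 2 β with hC
  have hC1 : 1 ≤ C := one_le_levelConst hβ
  obtain ⟨e, he⟩ := pow_unbounded_of_one_lt (4 * (256 * C)) (one_lt_two (α := ℝ))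
  refine ⟨e, 1 / (256 * C), by positivity, fun j N hej hj hN hs hNR => ?_⟩
  set R := 2 ^ (2 * j) with hR
  set K := 2 * j - e with hK
  obtain ⟨u, hum, huR, hu⟩ := exists_levels 2 hN R
  have huK := level_last_eq hs hN huR hu hNR
  have hu0 : u 0 ≤ 1 := by
    by_contra! h
    have h1 := (hu 0 1 (by have := huR 0; omega)).2 h
    have h2 := hs 0 (by positivity)
    rw [mul_zero, pow_zero] at h1
    rw [zero_add] at h2
    omega
  have hex : ∀ n, ∃ 𝓘, GoodShells 2 β N (u 0) (u n) 𝓘 ∧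
      ∑ k ∈ range n, (max (((u (k + 1) : ℝ) - u k) - 256 * C * 2 ^ k) 0) ^ 2 / (32 * C) ≤
        ((∑ I ∈ 𝓘, N I.1 : ℕ) : ℝ) := by
    intro n
    induction n with
    | zero => exact ⟨∅, GoodShells.empty _ _ _ _ _, by simp⟩
    | succ n ih =>
      obtain ⟨𝓘, h𝓘, h1⟩ := ih
      obtain ⟨𝓙, h𝓙, h2⟩ := exists_goodShells_level_two (k := n) hβ (le_refl (256 * C)) hs hN
        huR hu
      obtain ⟨h3, h4⟩ := h𝓘.union h𝓙 (hum (Nat.zero_le n)) (hum (Nat.le_succ n))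
      refine ⟨𝓘 ∪ 𝓙, h3, ?_⟩
      rw [h4, Finset.sum_range_succ]
      push_cast at h1 h2 ⊢
      linarith
  obtain ⟨𝓘, h𝓘, hsum⟩ := hex K
  refine ⟨𝓘, h𝓘.mono (Nat.zero_le _) huK.le, le_trans ?_ hsum⟩
  rw [← Finset.sum_div]
  set x : ℕ → ℝ := fun k => max (((u (k + 1) : ℝ) - u k) - 256 * C * 2 ^ k) 0 with hx
  have hRR : (R : ℝ) = 2 ^ (2 * j) := by rw [hR]; push_cast; rfl
  have hjR : (1 : ℝ) ≤ j := by exact_mod_cast hj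
  have hR4 : (4 : ℝ) ≤ R := by
    rw [hRR, pow_mul]
    calc (4 : ℝ) = (2 ^ 2) ^ 1 := by norm_num
      _ ≤ _ := pow_le_pow_right₀ (by norm_num) hj
  have hgeom : ∑ k ∈ range K, (2 : ℝ) ^ k ≤ 2 ^ K := by
    rw [geom_sum_eq (by norm_num)]
    norm_num
  have h2K : 256 * C * 2 ^ K ≤ R / 4 := by
    have h1 : (2 : ℝ) ^ K * 2 ^ e = R := by rw [hRR, ← pow_add]; congr 1; omega
    have h2 : (2 : ℝ) ^ K * (4 * (256 * C)) ≤ R := by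
      rw [← h1]; exact mul_le_mul_of_nonneg_left he.le (by positivity)
    linarith
  have hxsum : (R : ℝ) / 2 ≤ ∑ k ∈ range K, x k := by
    have h1 : ∑ k ∈ range K, (((u (k + 1) : ℝ) - u k) - 256 * C * 2 ^ k) ≤ ∑ k ∈ range K, x k :=
      Finset.sum_le_sum fun k _ => le_max_left _ _
    rw [Finset.sum_sub_distrib, Finset.sum_range_sub (fun k => (u k : ℝ)), ← Finset.mul_sum,
      huK] at h1
    have h2 : (u 0 : ℝ) ≤ 1 := by exact_mod_cast hu0
    have h3 : 256 * C * ∑ k ∈ range K, (2 : ℝ) ^ k ≤ 256 * C * 2 ^ K := by gcongr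
    linarith
  have hcs : (∑ k ∈ range K, x k) ^ 2 ≤ K * ∑ k ∈ range K, x k ^ 2 := by
    have := sq_sum_le_card_mul_sum_sq (s := range K) (f := x)
    rwa [Finset.card_range] at this
  have hK2 : (K : ℝ) ≤ 2 * j := by
    have : K ≤ 2 * j := by omega
    exact_mod_cast this
  have hx0 : 0 ≤ ∑ k ∈ range K, x k ^ 2 := Finset.sum_nonneg fun _ _ => sq_nonneg _
  have h5 : (R : ℝ) ^ 2 / 4 ≤ 2 * j * ∑ k ∈ range K, x k ^ 2 := by
    calc (R : ℝ) ^ 2 / 4 = (R / 2) ^ 2 := by ring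
      _ ≤ (∑ k ∈ range K, x k) ^ 2 := pow_le_pow_left₀ (by positivity) hxsum 2
      _ ≤ _ := hcs.trans (by gcongr)
  rw [← hRR, div_le_div_iff₀ (by positivity) (by positivity), div_mul_eq_mul_div, one_mul,
    div_mul_eq_mul_div, div_le_iff₀ (by positivity)]
  have h6 : 0 ≤ C := by linarith
  nlinarith [mul_le_mul_of_nonneg_left h5 h6]

/-! ### Good shells in dimension at least three -/

/-- In dimension at least three a single level suffices: by pigeonhole some level is thicker than
`C₁ 2 ^ k + R 2 ^ (- i) / 16`, where `i` is its position among the levels that hold at least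
`R / 2 ^ d` sites. -/
lemma exists_thick_level (hd : 3 ≤ d) {u N : ℕ → ℕ} {j e : ℕ} {C₁ : ℝ} (hC₁ : 0 < C₁)
    (he : 8 * C₁ ≤ 2 ^ e) (hej : e ≤ j) (hj : 1 ≤ j) (huR : ∀ k, u k ≤ 2 ^ (d * j))
    (hN : Monotone N) (hs : ∀ r < 2 ^ (d * j), N r < N (r + 1))
    (hu : ∀ k, ∀ r < 2 ^ (d * j), N r < 2 ^ (d * k) ↔ r < u k)
    (hNR : N (2 ^ (d * j)) ≤ 2 ^ (d * (d * j - e))) :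
    ∃ i, C₁ * 2 ^ (j - 1 + i) + 2 ^ (d * j) / 16 / 2 ^ i <
      (u (j - 1 + i + 1) : ℝ) - u (j - 1 + i) := by
  by_contra! hcon
  have huK := level_last_eq hs hN huR hu hNR
  set R : ℝ := 2 ^ (d * j) with hR
  have hstart : (u (j - 1) : ℝ) ≤ R / 8 := by
    have h1 : u (j - 1) ≤ 2 ^ (d * (j - 1)) := by
      by_contra! h
      have h2 := (hu (j - 1) _ (h.trans_le (huR _))).2 h
      have h3 := add_sub_le_of_strict (N := N) (u := 0) (v := 2 ^ (d * (j - 1)))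
        (fun r _ hr => hs r (hr.trans (h.trans_le (huR _)))) (Nat.zero_le _)
      omega
    have h2 : 2 ^ (d * (j - 1)) * 8 ≤ 2 ^ (d * j) := by
      calc 2 ^ (d * (j - 1)) * 8 = 2 ^ (d * (j - 1) + 3) := by rw [pow_add]; norm_num
        _ ≤ _ := Nat.pow_le_pow_right two_pos (by
          obtain ⟨j', rfl⟩ : ∃ j', j = j' + 1 := ⟨j - 1, by omega⟩
          rw [Nat.add_sub_cancel, Nat.mul_succ]; omega)
    have h3 : (u (j - 1) : ℝ) * 8 ≤ R := by
      rw [hR]; exact_mod_cast (Nat.mul_le_mul_right 8 h1).trans h2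
    linarith
  have hind : ∀ n, (u (j - 1 + n) : ℝ) ≤
      R / 8 + C₁ * 2 ^ (j - 1 + n) + R / 8 * (1 - 1 / 2 ^ n) := by
    intro n
    induction n with
    | zero =>
      have : 0 ≤ C₁ * 2 ^ (j - 1) := by positivity
      simp; linarith
    | succ n ih =>
      have h1 := hcon n
      have h2 : R / 8 * (1 - 1 / 2 ^ (n + 1)) = R / 8 * (1 - 1 / 2 ^ n) + R / 16 / 2 ^ n := by
        rw [pow_succ]; field_simp; ring
      have h3 : C₁ * 2 ^ (j - 1 + (n + 1)) = C₁ * 2 ^ (j - 1 + n) + C₁ * 2 ^ (j - 1 + n) := by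
        rw [← add_assoc, pow_succ]; ring
      rw [h2, h3, ← add_assoc (j - 1) n 1]
      linarith
  have hdj : j + e ≤ d * j := by nlinarith
  have hfin := hind (d * j - e - (j - 1))
  rw [show j - 1 + (d * j - e - (j - 1)) = d * j - e by omega, huK] at hfin
  have h1 : (2 : ℝ) ^ (d * j - e) * 2 ^ e = R := by rw [hR, ← pow_add]; congr 1; omega
  have h2 : C₁ * 2 ^ (d * j - e) ≤ R / 8 := by
    have := mul_le_mul_of_nonneg_left he (by positivity : (0 : ℝ) ≤ 2 ^ (d * j - e))
    linarith
  have h3 : R / 8 * (1 - 1 / 2 ^ (d * j - e - (j - 1))) ≤ R / 8 := by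
    refine mul_le_of_le_one_right (by positivity) ?_
    rw [sub_le_self_iff]; positivity
  have h4 : 0 < R := by positivity
  push_cast at hfin
  rw [← hR] at hfin
  linarith

/-- In dimension at least three the good shells can be chosen with `R ^ 2` sites inside them. -/
lemma exists_goodShells_of_three_le (hd : 3 ≤ d) {β : ℝ} (hβ : 0 < β) :
    ∃ (e : ℕ) (c : ℝ), 0 < c ∧ ∀ (j : ℕ) (N : ℕ → ℕ), e ≤ j → 1 ≤ j → Monotone N →
      (∀ r < 2 ^ (d * j), N r < N (r + 1)) → N (2 ^ (d * j)) ≤ 2 ^ (d * (d * j - e)) →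
      ∃ 𝓘, GoodShells d β N 0 (2 ^ (d * j)) 𝓘 ∧
        c * (2 ^ (d * j)) ^ 2 ≤ (∑ I ∈ 𝓘, N I.1 : ℕ) := by
  set C := levelConst d β with hC
  have hC1 : 1 ≤ C := one_le_levelConst hβ
  set Q : ℕ := 2 ^ (d + 4) with hQ
  have hQ16 : 16 ≤ Q := by
    calc 16 = 2 ^ 4 := by norm_num
      _ ≤ _ := Nat.pow_le_pow_right two_pos (by omega)
  have hQ1 : (1 : ℝ) ≤ Q := by exact_mod_cast (by omega : 1 ≤ Q)
  set C₁ : ℝ := 2 * (C * Q ^ d) with hC₁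
  have hCQ : 1 ≤ C * (Q : ℝ) ^ d := by
    calc (1 : ℝ) = 1 * 1 := by ring
      _ ≤ _ := mul_le_mul hC1 (one_le_pow₀ hQ1) zero_le_one (by linarith)
  obtain ⟨e, he⟩ := pow_unbounded_of_one_lt (8 * C₁) (one_lt_two (α := ℝ))
  -- `y` is `2 ^ (d + 1)` times the constant `c₃` with `q` about `c₃ R ^ 2 / M`
  set y : ℝ := 1 / (C * 32 ^ d) with hy
  have h32 : (1 : ℝ) ≤ 32 ^ d := one_le_pow₀ (by norm_num)
  have hy0 : 0 < y := by positivity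
  have hy1 : y ≤ 1 := by
    rw [hy, div_le_one (by positivity)]
    nlinarith
  refine ⟨e, y / 2 ^ (d + 2), by positivity, fun j N hej hj hN hs hNR => ?_⟩
  obtain ⟨u, hum, huR, hu⟩ := exists_levels d hN (2 ^ (d * j))
  obtain ⟨i, hi⟩ := exists_thick_level hd (by positivity : 0 < C₁) he.le hej hj huR hN hs hu hNR
  set k := j - 1 + i with hk
  set R : ℝ := 2 ^ (d * j) with hR
  set s : ℝ := 2 ^ i with hsdef
  have hs1 : 1 ≤ s := one_le_pow₀ one_le_two
  set M : ℝ := 2 ^ (d * k) with hM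
  have hMs : M * 2 ^ d = R * s ^ d := by
    rw [hM, hR, hsdef, ← pow_mul, ← pow_add, ← pow_add]
    congr 1
    obtain ⟨j', rfl⟩ : ∃ j', j = j' + 1 := ⟨j - 1, by omega⟩
    rw [hk, Nat.add_sub_cancel]
    ring
  have hM0 : 0 < M := by positivity
  have hR0 : 0 < R := by positivity
  have h2k : (1 : ℝ) ≤ 2 ^ k := one_le_pow₀ one_le_two
  set t : ℝ := (u (k + 1) : ℝ) - u k with ht
  have ht1 : C₁ * 2 ^ k ≤ t := by
    have : 0 < R / 16 / s := by positivity
    linarith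
  have ht2 : R / 16 / s ≤ t := by
    have : 0 < C₁ * 2 ^ k := by positivity
    linarith
  have htbig : 2 ≤ t := by
    have : C₁ * 1 ≤ C₁ * 2 ^ k := by gcongr
    linarith
  have hlt : u k < u (k + 1) := by
    have : (u k : ℝ) < u (k + 1) := by linarith
    exact_mod_cast this
  set t' : ℕ := u (k + 1) - 1 - u k with ht'
  have htt' : (t' : ℝ) = t - 1 := by
    have : t' + 1 + u k = u (k + 1) := by omega
    have : (t' : ℝ) + 1 + u k = u (k + 1) := by exact_mod_cast this
    linarith
  have hhalf : t / 2 ≤ t' := by linarith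
  -- with about `X` shells, the sites inside them number at least `X * M`, a multiple of `R ^ 2`
  set X : ℝ := y * R ^ 2 / (2 ^ (d + 1) * M) with hX
  set q := max Q ⌈X⌉₊ with hq
  have hqX : X ≤ q := (Nat.le_ceil X).trans (by exact_mod_cast le_max_right _ _)
  have hcond : C * M * (q : ℝ) ^ (d - 1) ≤ (t' : ℝ) ^ d := by
    rcases le_total ⌈X⌉₊ Q with hle | hle
    · have hqQ : q = Q := max_eq_left hle
      rw [hqQ]
      have h1 : (C * (Q : ℝ) ^ d * 2 ^ k) ^ d ≤ (t' : ℝ) ^ d :=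
        pow_le_pow_left₀ (by positivity) (by linarith) d
      have h2 : (C * (Q : ℝ) ^ d * 2 ^ k) ^ d = (C * (Q : ℝ) ^ d) ^ d * M := by
        rw [mul_pow _ ((2 : ℝ) ^ k), ← pow_mul, mul_comm k d]
      have h3 : C * (Q : ℝ) ^ d ≤ (C * (Q : ℝ) ^ d) ^ d := le_self_pow₀ hCQ (by omega)
      have h4 : (Q : ℝ) ^ (d - 1) ≤ (Q : ℝ) ^ d := pow_le_pow_right₀ hQ1 (by omega)
      calc C * M * (Q : ℝ) ^ (d - 1) ≤ C * M * (Q : ℝ) ^ d := by gcongr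
        _ = C * (Q : ℝ) ^ d * M := by ring
        _ ≤ (C * (Q : ℝ) ^ d) ^ d * M := by gcongr
        _ ≤ _ := by rw [← h2]; exact h1
    · have hqc : q = ⌈X⌉₊ := max_eq_right hle
      have hX1 : 1 ≤ X := by
        by_contra! h
        have : ⌈X⌉₊ ≤ 1 := Nat.ceil_le.2 (by exact_mod_cast h.le)
        omega
      have hq2 : (q : ℝ) ≤ y * R / s ^ d := by
        have h1 := Nat.ceil_lt_add_one (zero_le_one.trans hX1)
        rw [← hqc] at h1
        have h2 : 2 * X = y * R / s ^ d := by
          rw [hX, pow_succ (2 : ℝ) d, mul_right_comm, mul_comm ((2 : ℝ) ^ d) M, hMs]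
          field_simp
        linarith
      have hpow : (q : ℝ) ^ (d - 1) ≤ y * R ^ (d - 1) / s ^ (2 * d) := by
        calc (q : ℝ) ^ (d - 1) ≤ (y * R / s ^ d) ^ (d - 1) :=
              pow_le_pow_left₀ (Nat.cast_nonneg _) hq2 _
          _ = y ^ (d - 1) * R ^ (d - 1) / s ^ (d * (d - 1)) := by
              rw [div_pow, mul_pow, ← pow_mul s]
          _ ≤ _ := by
              have h1 : y ^ (d - 1) ≤ y := pow_le_of_le_one hy0.le hy1 (by omega)
              -- this is where `d ≥ 3` is needed
              have h2 : s ^ (2 * d) ≤ s ^ (d * (d - 1)) := by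
                refine pow_le_pow_right₀ hs1 ?_
                rw [mul_comm]
                exact Nat.mul_le_mul_left d (by omega)
              gcongr
      have hMle : M ≤ R * s ^ d := by
        rw [← hMs]
        exact le_mul_of_one_le_right hM0.le (one_le_pow₀ one_le_two)
      have ht32 : (R / (32 * s)) ^ d ≤ (t' : ℝ) ^ d := by
        refine pow_le_pow_left₀ (by positivity) (le_trans (le_trans (le_of_eq ?_)
          (div_le_div_of_nonneg_right ht2 two_pos.le)) hhalf) d
        field_simp
        norm_num
      calc C * M * (q : ℝ) ^ (d - 1) ≤ C * (R * s ^ d) * (y * R ^ (d - 1) / s ^ (2 * d)) := by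
            gcongr
        _ = (R / (32 * s)) ^ d := by
            obtain ⟨d', rfl⟩ : ∃ d', d = d' + 1 := ⟨d - 1, by omega⟩
            rw [hy, Nat.add_sub_cancel, div_pow R, mul_pow (32 : ℝ) s, two_mul, pow_add s, pow_succ R]
            clear_value R s
            field_simp
            ring
        _ ≤ _ := ht32
  obtain ⟨𝓘, h𝓘, hsum⟩ := exists_goodShells_of_levels (by omega) hβ hs hN huR hu hlt
    (q := q) (le_max_left _ _) hcond
  refine ⟨𝓘, h𝓘.mono (Nat.zero_le _) (huR _), ?_⟩
  have hsumR : (q : ℝ) * M ≤ 2 * (∑ I ∈ 𝓘, N I.1 : ℕ) := by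
    rw [hM]; exact_mod_cast hsum
  have h1 : y / 2 ^ (d + 2) * R ^ 2 * 2 = X * M := by
    rw [hX, pow_succ 2 (d + 1)]; field_simp
  have h2 : X * M ≤ q * M := by gcongr
  linarith

/-! ### Counting functions of the cluster -/

lemma countBall_mono (A : Finset (Lattice d)) (z : Lattice d) : Monotone (countBall A z) := by
  intro r s hrs
  refine Finset.card_le_card fun y hy => ?_
  rw [Finset.mem_filter] at hy ⊢
  exact ⟨hy.1, hy.2.trans_le (by exact_mod_cast hrs)⟩

/-- Every site of the cluster is the end of a walk from the origin inside the cluster. -/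
lemma exists_walk_of_mem_cluster {ω : Sample d} {n : ℕ} {z : Lattice d} (hz : z ∈ cluster ω n) :
    ∃ k t, walk ω k t = z ∧ ∀ s ≤ t, walk ω k s ∈ cluster ω n := by
  induction n with
  | zero => simp [cluster] at hz
  | succ n ih =>
    rw [cluster, Finset.mem_insert] at hz
    rcases hz with rfl | hz
    · refine ⟨n, exitTime ω n (cluster ω n), rfl, fun s hs => ?_⟩
      rw [cluster, Finset.mem_insert]
      rcases hs.lt_or_eq with h | rfl
      · exact Or.inr (walk_mem_of_lt_exitTime h)
      · exact Or.inl rfl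
    · obtain ⟨k, t, h1, h2⟩ := ih hz
      exact ⟨k, t, h1, fun s hs => Finset.mem_insert_of_mem (h2 s hs)⟩

/-- A cluster that contains `z` has sites in all shells of width one around `z` that do not
contain the origin. -/
lemma countBall_lt_succ {ω : Sample d} {n r : ℕ} {z : Lattice d} (hz : z ∈ cluster ω n)
    (hr : ((r + 1 : ℕ) : ℝ) ≤ euclNorm z) :
    countBall (cluster ω n) z r < countBall (cluster ω n) z (r + 1) := by
  obtain ⟨k, t, hkt, hmem⟩ := exists_walk_of_mem_cluster hz
  have hex : ∃ s, euclNorm (walk ω k s - z) < ((r + 1 : ℕ) : ℝ) :=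
    ⟨t, by rw [hkt, sub_self, euclNorm_zero]; positivity⟩
  classical
  set s := Nat.find hex with hs
  have hs1 : euclNorm (walk ω k s - z) < ((r + 1 : ℕ) : ℝ) := Nat.find_spec hex
  have hst : s ≤ t := Nat.find_min' hex (by rw [hkt, sub_self, euclNorm_zero]; positivity)
  have hs2 : (r : ℝ) ≤ euclNorm (walk ω k s - z) := by
    rcases Nat.eq_zero_or_pos s with h0 | hpos
    · exfalso
      rw [h0] at hs1
      simp only [walk, Finset.range_zero, Finset.sum_empty, zero_sub, euclNorm_neg] at hs1
      linarith
    · obtain ⟨s', hs'⟩ : ∃ s', s = s' + 1 := ⟨s - 1, by omega⟩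
      have h1 : ¬ euclNorm (walk ω k s' - z) < ((r + 1 : ℕ) : ℝ) :=
        Nat.find_min hex (by omega)
      have h2 := euclNorm_sub_le_add (walk ω k s') (walk ω k s) z
      have h3 : walk ω k s = walk ω k s' + (ω (k, s')).toVec := by
        rw [hs', walk, walk, Finset.sum_range_succ]
      rw [euclNorm_sub_comm (walk ω k s') (walk ω k s), h3, add_sub_cancel_left, euclNorm_toVec,
        ← h3] at h2
      push_cast at h1
      linarith
  refine Finset.card_lt_card (Finset.ssubset_iff_of_subset ?_ |>.2 ⟨walk ω k s, ?_, ?_⟩)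
  · intro y hy
    rw [Finset.mem_filter] at hy ⊢
    exact ⟨hy.1, hy.2.trans_le (by push_cast; linarith)⟩
  · exact Finset.mem_filter.2 ⟨hmem s hst, hs1⟩
  · rw [Finset.mem_filter, not_and, not_lt]
    exact fun _ => hs2

/-! ### From shells to probabilities -/

/-- The union bound over all counting functions of the cluster. -/
lemma exists_prob_countBall_le [NeZero d] {Γ : ℕ → ℝ}
    (hΓ : ∀ β : ℝ, 0 < β → ∃ (e : ℕ) (c : ℝ), 0 < c ∧ ∀ (j : ℕ) (N : ℕ → ℕ), e ≤ j → 1 ≤ j →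
      Monotone N → (∀ r < 2 ^ (d * j), N r < N (r + 1)) →
      N (2 ^ (d * j)) ≤ 2 ^ (d * (d * j - e)) →
      ∃ 𝓘, GoodShells d β N 0 (2 ^ (d * j)) 𝓘 ∧ c * Γ j ≤ (∑ I ∈ 𝓘, N I.1 : ℕ)) :
    ∃ (e : ℕ) (c : ℝ), 0 < c ∧ ∀ (j n : ℕ) (z : Lattice d), e ≤ j → 1 ≤ j →
      ((2 ^ (d * j) : ℕ) : ℝ) ≤ euclNorm z →
      (prob d).real {ω | z ∈ cluster ω n ∧
        countBall (cluster ω n) z (2 ^ (d * j)) ≤ 2 ^ (d * (d * j - e))} ≤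
        ((2 ^ (d * (d * j - e)) + 1) ^ (2 ^ (d * j) + 1) : ℕ) * Real.exp (-(c * Γ j / 8)) := by
  obtain ⟨β, hβ, hmain⟩ := exists_prob_le_exp d
  obtain ⟨e, c, hc, hcomb⟩ := hΓ β hβ
  refine ⟨e, c, hc, fun j n z hej hj hz => ?_⟩
  set R := 2 ^ (d * j) with hR
  set B := 2 ^ (d * (d * j - e)) with hB
  set E : Set (Sample d) := {ω | z ∈ cluster ω n ∧ countBall (cluster ω n) z R ≤ B} with hE
  set P : (Fin (R + 1) → Fin (B + 1)) → Set (Sample d) := fun g =>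
    {ω | ω ∈ E ∧ ∀ r : Fin (R + 1), countBall (cluster ω n) z r = g r} with hP
  have hcover : E ⊆ ⋃ g ∈ (Finset.univ : Finset (Fin (R + 1) → Fin (B + 1))), P g := by
    intro ω hω
    rw [Set.mem_iUnion₂]
    refine ⟨fun r => ⟨countBall (cluster ω n) z r, ?_⟩, Finset.mem_univ _, hω, fun r => rfl⟩
    exact Nat.lt_succ_of_le ((countBall_mono _ _ (Nat.le_of_lt_succ r.2)).trans hω.2)
  have hone : ∀ g, (prob d).real (P g) ≤ Real.exp (-(c * Γ j / 8)) := by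
    intro g
    rcases (P g).eq_empty_or_nonempty with hemp | ⟨ω₀, hω₀⟩
    · rw [hemp, measureReal_empty]; positivity
    set N := countBall (cluster ω₀ n) z with hN
    obtain ⟨𝓘, h𝓘, hsum⟩ := hcomb j N hej hj (countBall_mono _ _) (fun r hr =>
      countBall_lt_succ hω₀.1.1 (le_trans (by exact_mod_cast hr) hz)) hω₀.1.2
    have hle := hmain z 𝓘 h𝓘.disjoint h𝓘.width
      (fun I hI => le_trans (by exact_mod_cast h𝓘.le_right I hI) hz) N h𝓘.thin h𝓘.few n
    refine (measureReal_mono ?_ (measure_ne_top _ _)).trans (hle.trans ?_)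
    · intro ω hω I hI
      have hIR := h𝓘.le_right I hI
      have hsame : ∀ r ≤ R, countBall (cluster ω n) z r = N r := fun r hr =>
        (hω.2 ⟨r, Nat.lt_succ_of_le hr⟩).trans (hω₀.2 ⟨r, Nat.lt_succ_of_le hr⟩).symm
      exact ⟨hsame _ (by omega), hsame _ hIR⟩
    · rw [Real.exp_le_exp]
      linarith
  calc (prob d).real E ≤ (prob d).real (⋃ g ∈ Finset.univ, P g) :=
        measureReal_mono hcover (measure_ne_top _ _)
    _ ≤ ∑ g, (prob d).real (P g) := measureReal_biUnion_finset_le _ _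
    _ ≤ ∑ _g : Fin (R + 1) → Fin (B + 1), Real.exp (-(c * Γ j / 8)) :=
        Finset.sum_le_sum fun g _ => hone g
    _ = _ := by simp

lemma exists_sq_le_two_pow (C : ℝ) : ∃ j₀ : ℕ, ∀ j ≥ j₀, C * (j : ℝ) ^ 2 ≤ 2 ^ j := by
  have h := tendsto_pow_const_div_const_pow_of_one_lt 2 (one_lt_two (α := ℝ))
  have h2 := (h.const_mul C).eventually (ge_mem_nhds (by simp : C * 0 < 1))
  obtain ⟨j₀, hj₀⟩ := Filter.eventually_atTop.1 h2
  refine ⟨j₀, fun j hj => ?_⟩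
  have := hj₀ j hj
  rwa [← mul_div_assoc, div_le_one (by positivity)] at this

/-- The number of counting functions is negligible compared with the exponential gain. -/
lemma card_profiles_mul_exp_le {e j : ℕ} {c G : ℝ} (hd : 1 ≤ d) (hc : 0 < c) (hj : 1 ≤ j)
    (hG : (2 ^ (d * j)) ^ 2 / j ≤ G) (hlarge : 64 * d ^ 2 / c * (j : ℝ) ^ 2 ≤ 2 ^ j) :
    (((2 ^ (d * (d * j - e)) + 1) ^ (2 ^ (d * j) + 1) : ℕ) : ℝ) * Real.exp (-(c * G / 8)) ≤
      Real.exp (-(c * G / 16)) := by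
  have hjR : (1 : ℝ) ≤ j := by exact_mod_cast hj
  set R : ℝ := 2 ^ (d * j) with hR
  have hR1 : 1 ≤ R := one_le_pow₀ one_le_two
  have hdj : 1 ≤ d * j := Nat.mul_pos hd hj
  have hcount : (((2 ^ (d * (d * j - e)) + 1) ^ (2 ^ (d * j) + 1) : ℕ) : ℝ) ≤
      Real.exp (4 * d ^ 2 * j * R) := by
    have h1 : (2 ^ (d * (d * j - e)) + 1) ^ (2 ^ (d * j) + 1) ≤
        (2 ^ (2 * (d * (d * j)))) ^ (2 * 2 ^ (d * j)) := by
      have h2 : 2 ^ (d * (d * j - e)) + 1 ≤ 2 ^ (2 * (d * (d * j))) := by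
        calc 2 ^ (d * (d * j - e)) + 1 ≤ 2 ^ (d * (d * j)) + 2 ^ (d * (d * j)) :=
              Nat.add_le_add (Nat.pow_le_pow_right two_pos
                (Nat.mul_le_mul_left d (Nat.sub_le _ _))) Nat.one_le_two_pow
          _ = 2 ^ (d * (d * j) + 1) := by rw [pow_succ]; ring
          _ ≤ _ := Nat.pow_le_pow_right two_pos (by nlinarith)
      have h3 : 2 ^ (d * j) + 1 ≤ 2 * 2 ^ (d * j) := by
        have := Nat.one_le_two_pow (n := d * j)
        omega
      exact (Nat.pow_le_pow_left h2 _).trans (Nat.pow_le_pow_right (by positivity) h3)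
    rw [← pow_mul] at h1
    have h4 : (2 : ℝ) ≤ Real.exp 1 := by have := Real.exp_one_gt_d9; linarith
    calc _ ≤ (2 : ℝ) ^ (2 * (d * (d * j)) * (2 * 2 ^ (d * j))) := by exact_mod_cast h1
      _ ≤ Real.exp 1 ^ (2 * (d * (d * j)) * (2 * 2 ^ (d * j))) :=
          pow_le_pow_left₀ two_pos.le h4 _
      _ = _ := by
          rw [← Real.exp_nat_mul, hR]
          congr 1
          push_cast
          ring
  have hbig : 4 * (d : ℝ) ^ 2 * j * R ≤ c * G / 16 := by
    have h1 : (2 : ℝ) ^ j ≤ R := pow_le_pow_right₀ one_le_two (by nlinarith)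
    have h2 : 64 * (d : ℝ) ^ 2 * j ^ 2 ≤ c * R := by
      have := hlarge.trans h1
      rw [div_mul_eq_mul_div, div_le_iff₀ hc] at this
      linarith
    have h3 : 64 * (d : ℝ) ^ 2 * j * R ≤ c * (R ^ 2 / j) := by
      rw [← mul_div_assoc, le_div_iff₀ (by positivity)]
      nlinarith
    have h4 : c * (R ^ 2 / j) ≤ c * G := by gcongr
    linarith
  calc _ ≤ Real.exp (4 * d ^ 2 * j * R) * Real.exp (-(c * G / 8)) := by gcongr
    _ ≤ _ := by
      rw [← Real.exp_add, Real.exp_le_exp]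
      linarith

lemma countBall_le_ncard (A : Finset (Lattice d)) (z : Lattice d) {r : ℕ} {m : ℝ}
    (h : (r : ℝ) ≤ m) :
    countBall A z r ≤ ((A : Set (Lattice d)) ∩ ball z m).ncard := by
  unfold countBall
  rw [← Set.ncard_coe_finset]
  refine Set.ncard_le_ncard (fun y hy => ?_) (A.finite_toSet.inter_of_left _)
  rw [Finset.mem_coe, Finset.mem_filter] at hy
  exact ⟨hy.1, hy.2.trans_le h⟩

lemma le_euclNorm_of_notMem_ball {z : Lattice d} {m : ℝ} (h : (0 : Lattice d) ∉ ball z m) :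
    m ≤ euclNorm z := by
  have : ¬ euclNorm (0 - z) < m := h
  rwa [zero_sub, euclNorm_neg, not_lt] at this

/-- A tentacle contains its tip, so that it cannot have less than one site. For small radii this is
all that is needed. -/
lemma thinTentacle_eq_empty (n : ℕ) (z : Lattice d) {m v : ℝ} (hm : 0 < m) (hv : v < 1) :
    thinTentacle n z m v = ∅ := by
  refine Set.eq_empty_of_forall_notMem fun ω hω => ?_
  have hfin : ((cluster ω n : Set (Lattice d)) ∩ ball z m).Finite :=
    (cluster ω n).finite_toSet.inter_of_left _
  have hz : z ∈ (cluster ω n : Set (Lattice d)) ∩ ball z m := by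
    refine ⟨hω.1, ?_⟩
    change euclNorm (z - z) < m
    simpa using hm
  have h1 : 1 ≤ ((cluster ω n : Set (Lattice d)) ∩ ball z m).ncard :=
    (Set.ncard_pos hfin).2 ⟨z, hz⟩
  have h2 : (1 : ℝ) ≤ (((cluster ω n : Set (Lattice d)) ∩ ball z m).ncard : ℝ) := by
    exact_mod_cast h1
  linarith [hω.2]

/-- The estimate for radii between two consecutive powers of `2 ^ d`, in terms of the number `Γ j`
of sites inside good shells. -/
lemma exists_prob_thinTentacle_le [NeZero d] {Γ : ℕ → ℝ}
    (hΓ : ∀ β : ℝ, 0 < β → ∃ (e : ℕ) (c : ℝ), 0 < c ∧ ∀ (j : ℕ) (N : ℕ → ℕ), e ≤ j → 1 ≤ j →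
      Monotone N → (∀ r < 2 ^ (d * j), N r < N (r + 1)) →
      N (2 ^ (d * j)) ≤ 2 ^ (d * (d * j - e)) →
      ∃ 𝓘, GoodShells d β N 0 (2 ^ (d * j)) 𝓘 ∧ c * Γ j ≤ (∑ I ∈ 𝓘, N I.1 : ℕ))
    (hΓ' : ∀ j : ℕ, 1 ≤ j → (2 ^ (d * j)) ^ 2 / j ≤ Γ j) :
    ∃ b c : ℝ, 0 < b ∧ 0 < c ∧ ∀ (m : ℝ) (z : Lattice d) (n : ℕ), 0 < m →
      (0 : Lattice d) ∉ ball z m → thinTentacle n z m (b * m ^ d) = ∅ ∨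
        ∃ j : ℕ, 1 ≤ j ∧ 2 ^ (d * j) ≤ m ∧ m < 2 ^ d * 2 ^ (d * j) ∧
          (prob d).real (thinTentacle n z m (b * m ^ d)) ≤ Real.exp (-(c * Γ j)) := by
  obtain ⟨e, c, hc, hmain⟩ := exists_prob_countBall_le hΓ
  obtain ⟨j₁, hj₁⟩ := exists_sq_le_two_pow (64 * d ^ 2 / c)
  have hd : 1 ≤ d := Nat.one_le_iff_ne_zero.2 (NeZero.ne d)
  set j₀ := max (max e 1) j₁ with hj₀
  refine ⟨1 / (2 ^ (d * (d + e)) * (2 ^ (d * j₀)) ^ d), c / 16, by positivity, by positivity,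
    fun m z n hm hz => ?_⟩
  rcases lt_or_ge m (2 ^ (d * j₀)) with hsmall | hlarge
  · left
    refine thinTentacle_eq_empty n z hm ?_
    rw [div_mul_eq_mul_div, one_mul, div_lt_one (by positivity)]
    calc m ^ d < (2 ^ (d * j₀)) ^ d := pow_lt_pow_left₀ hsmall hm.le (by omega)
      _ ≤ _ := le_mul_of_one_le_left (by positivity) (one_le_pow₀ one_le_two)
  · right
    obtain ⟨j, hj1, hj2⟩ := exists_nat_pow_near
      (le_trans (one_le_pow₀ (one_le_two (α := ℝ))) hlarge)
      (one_lt_pow₀ (one_lt_two (α := ℝ)) (by omega : d ≠ 0))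
    rw [← pow_mul] at hj1
    rw [pow_succ, ← pow_mul, mul_comm] at hj2
    have hjj₀ : j₀ ≤ j := by
      by_contra! hlt
      have h1 : (2 : ℝ) ^ d * 2 ^ (d * j) ≤ 2 ^ (d * j₀) := by
        rw [← pow_add]
        refine pow_le_pow_right₀ one_le_two ?_
        calc d + d * j = d * (j + 1) := by ring
          _ ≤ d * j₀ := Nat.mul_le_mul_left d hlt
      linarith
    have hej : e ≤ j := by omega
    have hj : 1 ≤ j := by omega
    refine ⟨j, hj, hj1, hj2, ?_⟩
    have hsub : thinTentacle n z m (1 / (2 ^ (d * (d + e)) * (2 ^ (d * j₀)) ^ d) * m ^ d) ⊆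
        {ω | z ∈ cluster ω n ∧
          countBall (cluster ω n) z (2 ^ (d * j)) ≤ 2 ^ (d * (d * j - e))} := by
      intro ω hω
      refine ⟨hω.1, ?_⟩
      have h1 : countBall (cluster ω n) z (2 ^ (d * j)) ≤
          ((cluster ω n : Set (Lattice d)) ∩ ball z m).ncard :=
        countBall_le_ncard _ _ (by push_cast; exact hj1)
      have h2 : (countBall (cluster ω n) z (2 ^ (d * j)) : ℝ) ≤
          1 / (2 ^ (d * (d + e)) * (2 ^ (d * j₀)) ^ d) * m ^ d :=
        le_trans (by exact_mod_cast h1) hω.2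
      have h3 : (2 : ℝ) ^ (d * (d * j - e)) * 2 ^ (d * (d + e)) = (2 ^ d * 2 ^ (d * j)) ^ d := by
        have hle : e ≤ d * j := hej.trans (Nat.le_mul_of_pos_left j hd)
        obtain ⟨f, hf⟩ := Nat.exists_eq_add_of_le hle
        rw [hf, Nat.add_sub_cancel_left, ← pow_add, ← pow_add, ← pow_mul]
        congr 1
        ring
      have h4 : 1 / (2 ^ (d * (d + e)) * ((2 : ℝ) ^ (d * j₀)) ^ d) * m ^ d ≤
          2 ^ (d * (d * j - e)) := by
        rw [div_mul_eq_mul_div, one_mul, div_le_iff₀ (by positivity), ← mul_assoc, h3]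
        calc m ^ d ≤ (2 ^ d * 2 ^ (d * j)) ^ d := pow_le_pow_left₀ hm.le hj2.le d
          _ ≤ _ := le_mul_of_one_le_right (by positivity)
            (one_le_pow₀ (one_le_pow₀ one_le_two))
      exact_mod_cast h2.trans h4
    refine (measureReal_mono hsub (measure_ne_top _ _)).trans ((hmain j n z hej hj ?_).trans ?_)
    · push_cast
      exact hj1.trans (le_euclNorm_of_notMem_ball hz)
    · refine (card_profiles_mul_exp_le hd hc hj (hΓ' j hj) (hj₁ j (by omega))).trans
        (le_of_eq ?_)
      congr 1
      ring

end IDLA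

theorem lemmaA :
    (∃ b C₀ c : ℝ, 0 < b ∧ 0 < C₀ ∧ 0 < c ∧
      ∀ (m : ℝ) (z : IDLA.Lattice 2) (n : ℕ), 0 < m → (0 : IDLA.Lattice 2) ∉ IDLA.ball z m →
        (IDLA.prob 2).real (IDLA.thinTentacle n z m (b * m ^ 2)) ≤
          C₀ * Real.exp (-(c * m ^ 2 / Real.log m))) ∧
    (∀ (d : ℕ) [NeZero d], 3 ≤ d → ∃ b C₀ c : ℝ, 0 < b ∧ 0 < C₀ ∧ 0 < c ∧
      ∀ (m : ℝ) (z : IDLA.Lattice d) (n : ℕ), 0 < m → (0 : IDLA.Lattice d) ∉ IDLA.ball z m →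
        (IDLA.prob d).real (IDLA.thinTentacle n z m (b * m ^ d)) ≤
          C₀ * Real.exp (-(c * m ^ 2))) := by
  constructor
  · obtain ⟨b, c, hb, hc, h⟩ := IDLA.exists_prob_thinTentacle_le (d := 2)
      (Γ := fun j => (2 ^ (2 * j)) ^ 2 / j) (fun β hβ => by
        obtain ⟨e, c, hc, h⟩ := IDLA.exists_goodShells_two hβ
        refine ⟨e, c, hc, fun j N h1 h2 h3 h4 h5 => ?_⟩
        obtain ⟨𝓘, h6, h7⟩ := h j N h1 h2 h3 h4 h5
        exact ⟨𝓘, h6, by rw [← mul_div_assoc]; exact h7⟩) fun j _ => le_rfl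
    refine ⟨b, 1, c / 16, hb, one_pos, by positivity, fun m z n hm hz => ?_⟩
    rw [one_mul]
    rcases h m z n hm hz with hemp | ⟨j, hj, hj1, hj2, hle⟩
    · rw [hemp, MeasureTheory.measureReal_empty]; positivity
    · refine hle.trans (Real.exp_le_exp.2 (neg_le_neg ?_))
      have hjR : (1 : ℝ) ≤ j := by exact_mod_cast hj
      have hlog : (j : ℝ) ≤ Real.log m := by
        have h1 := Real.log_le_log (by positivity) hj1
        rw [Real.log_pow] at h1
        push_cast at h1
        have := Real.log_two_gt_d9
        nlinarith
      calc c / 16 * m ^ 2 / Real.log m ≤ c / 16 * (2 ^ 2 * 2 ^ (2 * j)) ^ 2 / j := by gcongr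
        _ = c * ((2 ^ (2 * j)) ^ 2 / j) := by ring
  · intro d _ hd
    obtain ⟨b, c, hb, hc, h⟩ := IDLA.exists_prob_thinTentacle_le (d := d)
      (Γ := fun j => (2 ^ (d * j)) ^ 2) (fun β hβ => IDLA.exists_goodShells_of_three_le hd hβ)
      fun j hj => div_le_self (by positivity) (by exact_mod_cast hj)
    refine ⟨b, 1, c / (2 ^ d) ^ 2, hb, one_pos, by positivity, fun m z n hm hz => ?_⟩
    rw [one_mul]
    rcases h m z n hm hz with hemp | ⟨j, hj, hj1, hj2, hle⟩
    · rw [hemp, MeasureTheory.measureReal_empty]; positivity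
    · refine hle.trans (Real.exp_le_exp.2 (neg_le_neg ?_))
      calc c / (2 ^ d) ^ 2 * m ^ 2 ≤ c / (2 ^ d) ^ 2 * (2 ^ d * 2 ^ (d * j)) ^ 2 := by gcongr
        _ = c * (2 ^ (d * j)) ^ 2 := by rw [mul_pow]; field_simp
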